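/- **Proposition 2.3.** Let $[n]=\{0,\dots,n\}$, $P=\mathbb C[x_0,\dots,x_n]$, and let $X$ be a simplicial complex on $[n]$, i.e. a family of subsets of $[n]$ closed under taking subsets (the empty set counts as a face; not every $i\in[n]$ need be a vertex). For $p\subseteq[n]$ write $\mathbf x^p=\prod_{i\in p}x_i$ and identify $p$ with its characteristic vector. Let $I_X=\langle \mathbf x^p\mid p\notin X\rangle\subseteq P$ and $A_X=P/I_X$. Let $j:F\to P$, $e_p\mapsto\mathbf x^p$, where $F$ is the free $P$-module with basis $\{e_p\mid p\subseteq[n],\,p\notin X\}$, let $R=\ker j$, let $R_0=\langle j(f)e-j(e)f\mid e,f\in F\rangle\subseteq R$, and let $$T^2=\operatorname{coker}\bigl(\operatorname{Hom}_P(F,A_X)\to\operatorname{Hom}_{A_X}(R/R_0,A_X)\bigr).$$ All these modules are $\mathbb Z^{n+1}$-graded by $\deg x_i=\mathbf e_i$ (the $i$-th unit vector) and $\deg e_p=p$. For $\mathbf c\in\mathbb Z^{n+1}$ let $\operatorname{Hom}(I_X,A_X)_{\mathbf c}$ and $T^2_{\mathbf c}(X)$ be the degree $\mathbf c$ parts of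 $\operatorname{Hom}_P(I_X,A_X)$ and of $T^2$. An element of $\operatorname{Hom}(I_X,A_X)_{\mathbf c}$ is called a *trivial deformation* if it lies in the image of the map $\operatorname{Der}_{\mathbb C}(P,P)_{\mathbf c}\to\operatorname{Hom}_P(I_X,A_X)$, $D\mapsto(f\mapsto D(f)\bmod I_X)$. Write $\mathbf c=\mathbf a-\mathbf b$ with $\mathbf a,\mathbf b\in\mathbb N^{n+1}$ of disjoint supports $a,b\subseteq[n]$, and put $$N_{a-b}=\{f\in X\mid a\subseteq f,\ f\cap b=\emptyset,\ f\cup b\notin X\},$$ $$\widetilde N_{a-b}=\{f\in N_{a-b}\mid f\cup b'\notin X\text{ for some proper subset }b'\subsetneq b\},$$ $$N^{(2)}_{a-b}=\{(f,g)\in N_{a-b}\times N_{a-b}\mid f\cup g\in X\},\qquad \Phi(p)=(p\cup a)\setminus b .$$ Then $\operatorname{Hom}(I_X,A_X)_{\mathbf c}$ and $T^2_{\mathbf c}(X)$ vanish unless $\mathbf b\in\{0,1\}^{n+1}$. If $\mathbf b\in\{0,1\}^{n+1}$, these vector spaces depend, up to isomorphism, only on $a$ and $b$; more precisely, with the convention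 $\mathbf x^{\mathbf u}=0$ if $\mathbf u\in\mathbb Z^{n+1}$ has a negative entry: (i) There is a $\mathbb C$-linear isomorphism $\varphi\mapsto\lambda_\varphi$ from $\operatorname{Hom}(I_X,A_X)_{\mathbf c}$ onto the space of functions $\lambda:N_{a-b}\to\mathbb C$ such that $\lambda(f)=0$ for $f\in\widetilde N_{a-b}$, and $\lambda(f)=\lambda(g)$ whenever $f\cup g\in X$. It is characterized by $\varphi(\mathbf x^p)=\lambda_\varphi(\Phi(p))\,\mathbf x^{p+\mathbf c}$ in $A_X$ for all $p\notin X$ with $\Phi(p)\in N_{a-b}$. (ii) An element $\varphi\in\operatorname{Hom}(I_X,A_X)_{\mathbf c}$ is a trivial deformation if and only if $\varphi=0$, or $\#b=1$ and $\lambda_\varphi$ is constant. (iii) $T^2_{\mathbf c}(X)$ is isomorphic to the quotient of the space of antisymmetric functions $\lambda:N^{(2)}_{a-b}\to\mathbb C$ satisfying $$\lambda(f,g)=0\ \text{ if } f,g\in\widetilde N_{a-b},\qquad \lambda(f,g)-\lambda(f,h)+\lambda(g,h)=0\ \text{ if } f\cup g\cup h\in X,$$ by the subspace of the functions $(f,g)\mapsto\lambda(f)-\lambda(g)$,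 where $\lambda:N_{a-b}\to\mathbb C$ vanishes on $\widetilde N_{a-b}$. The isomorphism can be chosen such that the class of $\lambda$ corresponds to the class in $T^2$ of a homomorphism $\varphi:R/R_0\to A_X$, homogeneous of degree $\mathbf c$, with $$\varphi\bigl(\mathbf x^{q\setminus p}e_p-\mathbf x^{p\setminus q}e_q\bigr)=\lambda(\Phi(p),\Phi(q))\,\mathbf x^{(p\cup q)+\mathbf c}$$ for all $p,q\notin X$ with $(\Phi(p),\Phi(q))\in N^{(2)}_{a-b}$. -/

import Mathlib

/-! # Stanley–Reisner rings and the graded pieces of their cotangent cohomology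

The vertex set is `[n] = {0, …, n} = Fin (n + 1)` and the base field is `ℂ`. -/

namespace StanleyReisner

noncomputable section

/-! ## Stanley–Reisner rings -/

/-- A simplicial complex on (a subset of) `[n]`: a family of subsets of `[n]` closed under passing
to subsets.  The empty set is regarded as a face, and not every `i : [n]` need be a vertex. -/
abbrev Complex (n : ℕ) : Type := LowerSet (Finset (Fin (n + 1)))

/-- The ambient polynomial ring `P = ℂ[x₀, …, xₙ]`. -/
abbrev Poly (n : ℕ) : Type := MvPolynomial (Fin (n + 1)) ℂ

/-- Multidegrees `ℤ^{n+1}`. -/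
abbrev Deg (n : ℕ) : Type := Fin (n + 1) → ℤ

variable {n : ℕ}

/-- The square-free monomial `x^p` of a subset `p ⊆ [n]`. -/
def sqfree (p : Finset (Fin (n + 1))) : Poly n := ∏ i ∈ p, MvPolynomial.X i

/-- A subset `p ⊆ [n]` as a multidegree: its characteristic vector. -/
def charVec (p : Finset (Fin (n + 1))) : Deg n := fun i => if i ∈ p then 1 else 0

/-- The Stanley–Reisner ideal `I_X = ⟨x^p | p ∉ X⟩`. -/
def ideal (X : Complex n) : Ideal (Poly n) := Ideal.span {m | ∃ p, p ∉ X ∧ m = sqfree p}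

/-- The Stanley–Reisner ring `A_X = P / I_X`. -/
abbrev SRing (X : Complex n) : Type := Poly n ⧸ ideal X

/-- The quotient map `P → A_X`, as a map of `P`-modules. -/
abbrev toRing (X : Complex n) : Poly n →ₗ[Poly n] SRing X := (ideal X).mkQ

/-- The type of non-faces `p ⊆ [n]`, `p ∉ X`; these index the generators `x^p` of `I_X`. -/
abbrev NonFace (X : Complex n) : Type := {p : Finset (Fin (n + 1)) // p ∉ X}

/-- The generator `x^p` of `I_X`, as an element of `I_X`. -/
def gen (X : Complex n) (p : NonFace X) : ideal X :=
  ⟨sqfree p.1, Ideal.subset_span ⟨p.1, p.2, rfl⟩⟩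

/-- The monomial `x^u ∈ P` for `u ∈ ℤ^{n+1}`, with the convention `x^u = 0` if `u` has a negative
entry. -/
def zMonomial (u : Deg n) : Poly n :=
  if ∀ i, 0 ≤ u i then
    MvPolynomial.monomial (Finsupp.equivFunOnFinite.symm fun i => (u i).toNat) 1
  else 0

/-! ## `Hom(I_X, A_X)` and `T²` -/

/-- Restriction of derivations: `Der_ℂ(P, P) → Hom_P(I_X, A_X)`, `D ↦ (f ↦ D f mod I_X)`.
Its cokernel is `T¹`, its image consists of the trivial deformations. -/
def derToHom (X : Complex n) :
    Derivation ℂ (Poly n) (Poly n) →ₗ[Poly n] (ideal X →ₗ[Poly n] SRing X) where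
  toFun D :=
    { toFun := fun f => toRing X (D f.1)
      map_add' := fun f g => by simp
      map_smul' := fun r f => by
        have h : toRing X (f.1 * D r) = 0 :=
          (Submodule.Quotient.mk_eq_zero _).2 ((ideal X).mul_mem_right _ f.2)
        have e : D (r • f : ideal X).1 = r • D f.1 + f.1 * D r := by
          simp [Derivation.leibniz, smul_eq_mul]
        rw [e, map_add, h, add_zero, map_smul, RingHom.id_apply] }
  map_add' D E := by ext f; simp
  map_smul' r D := LinearMap.ext fun f => map_smul (toRing X) r (D f.1)

/-- The free module `P^m` with basis `e_p`, `p ∉ X`. -/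
abbrev Free (X : Complex n) : Type := NonFace X → Poly n

instance (X : Complex n) : Fintype (NonFace X) := Fintype.ofFinite _

/-- The presentation `j : P^m → P`, `e_p ↦ x^p`, with image `I_X`. -/
def pres (X : Complex n) : Free X →ₗ[Poly n] Poly n :=
  Fintype.linearCombination (Poly n) fun p : NonFace X => sqfree p.1

/-- The module of relations `R = ker j`. -/
def rel (X : Complex n) : Submodule (Poly n) (Free X) := LinearMap.ker (pres X)

/-- The Koszul relations `R₀ = ⟨j(f) e - j(e) f⟩`. -/
def koszul (X : Complex n) : Submodule (Poly n) (Free X) :=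
  Submodule.span (Poly n) {r | ∃ e f : Free X, r = pres X f • e - pres X e • f}

lemma koszul_le_rel (X : Complex n) : koszul X ≤ rel X := by
  refine Submodule.span_le.2 ?_
  rintro _ ⟨e, f, rfl⟩
  simp [rel, mul_comm]

/-- The module `R / R₀`. -/
abbrev RelMod (X : Complex n) : Type := rel X ⧸ (koszul X).submoduleOf (rel X)

/-- The quotient map `R → R / R₀`. -/
abbrev toRelMod (X : Complex n) : rel X →ₗ[Poly n] RelMod X :=
  ((koszul X).submoduleOf (rel X)).mkQ

lemma pres_mem_ideal (X : Complex n) (e : Free X) : pres X e ∈ ideal X := by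
  rw [pres, Fintype.linearCombination_apply]
  exact Submodule.sum_mem _ fun p _ => (ideal X).mul_mem_left _ (gen X p).2

lemma ideal_smul_ring (X : Complex n) {f : Poly n} (hf : f ∈ ideal X) (y : SRing X) :
    f • y = 0 := by
  obtain ⟨g, rfl⟩ := Submodule.Quotient.mk_surjective _ y
  rw [← Submodule.Quotient.mk_smul]
  exact (Submodule.Quotient.mk_eq_zero _).2 ((ideal X).mul_mem_right _ hf)

lemma koszul_le_ker (X : Complex n) (ψ : Free X →ₗ[Poly n] SRing X) :
    (koszul X).submoduleOf (rel X) ≤ LinearMap.ker (ψ ∘ₗ (rel X).subtype) := by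
  have h : koszul X ≤ LinearMap.ker ψ := by
    refine Submodule.span_le.2 ?_
    rintro _ ⟨e, f, rfl⟩
    simp [ideal_smul_ring X (pres_mem_ideal X _)]
  exact fun r hr => h hr

/-- The induced map `Hom_P(P^m, A_X) → Hom(R/R₀, A_X)`: restrict to `R` and factor through
`R/R₀`. -/
def freeToHom (X : Complex n) :
    (Free X →ₗ[Poly n] SRing X) →ₗ[Poly n] (RelMod X →ₗ[Poly n] SRing X) where
  toFun ψ := ((koszul X).submoduleOf (rel X)).liftQ (ψ ∘ₗ (rel X).subtype) (koszul_le_ker X ψ)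
  map_add' ψ χ := by ext r; simp
  map_smul' r ψ := by ext s; simp

/-- `T²` of `A_X`: the cokernel of `Hom_P(P^m, A_X) → Hom_{A_X}(R/R₀, A_X)`.  As `P → A_X` is
surjective, `A_X`-linear maps `R/R₀ → A_X` are the same as `P`-linear maps. -/
abbrev T2 (X : Complex n) : Type :=
  (RelMod X →ₗ[Poly n] SRing X) ⧸ LinearMap.range (freeToHom X)

/-- The projection `Hom(R/R₀, A_X) → T²`. -/
abbrev toT2 (X : Complex n) : (RelMod X →ₗ[Poly n] SRing X) →ₗ[Poly n] T2 X :=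
  (LinearMap.range (freeToHom X)).mkQ

lemma sqfree_mul (p q : Finset (Fin (n + 1))) : sqfree (q \ p) * sqfree p = sqfree (p ∪ q) := by
  rw [sqfree, sqfree, sqfree, ← Finset.prod_union Finset.sdiff_disjoint,
    Finset.sdiff_union_self_eq_union, Finset.union_comm]

/-- The relation `R_{p,q} = x^{q∖p} e_p - x^{p∖q} e_q`. -/
def taylorRel (X : Complex n) (p q : NonFace X) : rel X :=
  ⟨Pi.single p (sqfree (q.1 \ p.1)) - Pi.single q (sqfree (p.1 \ q.1)), by
    simp [rel, pres, sqfree_mul, Finset.union_comm q.1 p.1]⟩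

/-! ## The `ℤ^{n+1}`-gradings -/

/-- The degree `u` part of `P`, where `deg x_i` is the `i`-th unit vector. -/
def polyDeg (u : Deg n) : Submodule ℂ (Poly n) :=
  MvPolynomial.weightedHomogeneousSubmodule ℂ (fun i => (Pi.single i 1 : Deg n)) u

/-- The degree `u` part of `A_X`. -/
def ringDeg (X : Complex n) (u : Deg n) : Submodule ℂ (SRing X) :=
  (polyDeg u).map ((toRing X).restrictScalars ℂ)

/-- The degree `u` part of `I_X`. -/
def idealDeg (X : Complex n) (u : Deg n) : Submodule ℂ (ideal X) :=
  (polyDeg u).comap ((ideal X).subtype.restrictScalars ℂ)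

/-- The degree `u` part of `P^m`, where `deg e_p = p`. -/
def freeDeg (X : Complex n) (u : Deg n) : Submodule ℂ (Free X) :=
  ⨅ p : NonFace X, (polyDeg (u - charVec p.1)).comap
    ((LinearMap.proj (R := Poly n) (φ := fun _ : NonFace X => Poly n) p).restrictScalars ℂ)

/-- The degree `u` part of `R / R₀`. -/
def relModDeg (X : Complex n) (u : Deg n) : Submodule ℂ (RelMod X) :=
  ((freeDeg X u).comap ((rel X).subtype.restrictScalars ℂ)).map
    ((toRelMod X).restrictScalars ℂ)

/-- `Hom(I_X, A_X)_c`: the `P`-linear maps that are homogeneous of degree `c`. -/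
def HomDeg (X : Complex n) (c : Deg n) : Submodule ℂ (ideal X →ₗ[Poly n] SRing X) where
  carrier := {φ | ∀ u, ∀ x ∈ idealDeg X u, φ x ∈ ringDeg X (u + c)}
  add_mem' h h' u x hx := Submodule.add_mem _ (h u x hx) (h' u x hx)
  zero_mem' _ _ _ := Submodule.zero_mem _
  smul_mem' z _ h u x hx := Submodule.smul_mem _ z (h u x hx)

/-- `Der_ℂ(P, P)_c`: the derivations that are homogeneous of degree `c`. -/
def DerDeg (c : Deg n) : Submodule ℂ (Derivation ℂ (Poly n) (Poly n)) where
  carrier := {D | ∀ u, ∀ x ∈ polyDeg u, D x ∈ polyDeg (u + c)}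
  add_mem' h h' u x hx := Submodule.add_mem _ (h u x hx) (h' u x hx)
  zero_mem' _ _ _ := Submodule.zero_mem _
  smul_mem' z _ h u x hx := Submodule.smul_mem _ z (h u x hx)

/-- The trivial deformations of degree `c`: the image of `Der_ℂ(P, P)_c` in `Hom(I_X, A_X)`. -/
def TrivialDeg (X : Complex n) (c : Deg n) : Submodule ℂ (ideal X →ₗ[Poly n] SRing X) :=
  (DerDeg c).map ((derToHom X).restrictScalars ℂ)

/-- `Hom(R/R₀, A_X)_c`: the linear maps that are homogeneous of degree `c`. -/
def RelHomDeg (X : Complex n) (c : Deg n) : Submodule ℂ (RelMod X →ₗ[Poly n] SRing X) where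
  carrier := {φ | ∀ u, ∀ x ∈ relModDeg X u, φ x ∈ ringDeg X (u + c)}
  add_mem' h h' u x hx := Submodule.add_mem _ (h u x hx) (h' u x hx)
  zero_mem' _ _ _ := Submodule.zero_mem _
  smul_mem' z _ h u x hx := Submodule.smul_mem _ z (h u x hx)

/-- `T²_c(X)`: the degree `c` part of `T²`. -/
def T2Deg (X : Complex n) (c : Deg n) : Submodule ℂ (T2 X) :=
  (RelHomDeg X c).map ((toT2 X).restrictScalars ℂ)

/-! ## The combinatorial side -/

/-- The support `a` of the positive part of `c`. -/
def posSupp (c : Deg n) : Finset (Fin (n + 1)) := Finset.univ.filter fun i => 0 < c i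

/-- The support `b` of the negative part of `c`. -/
def negSupp (c : Deg n) : Finset (Fin (n + 1)) := Finset.univ.filter fun i => c i < 0

/-- `N_{a-b} = {f ∈ X | a ⊆ f, f ∩ b = ∅, f ∪ b ∉ X}`. -/
def N (X : Complex n) (a b : Finset (Fin (n + 1))) : Set (Finset (Fin (n + 1))) :=
  {f | f ∈ X ∧ a ⊆ f ∧ f ∩ b = ∅ ∧ f ∪ b ∉ X}

/-- `Ñ_{a-b}`: those `f ∈ N_{a-b}` with `f ∪ b' ∉ X` for some proper subset `b'` of `b`. -/
def NTilde (X : Complex n) (a b : Finset (Fin (n + 1))) : Set (Finset (Fin (n + 1))) :=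
  {f | f ∈ N X a b ∧ ∃ b', b' ⊂ b ∧ f ∪ b' ∉ X}

/-- `N^{(2)}_{a-b}`: the pairs `(f, g)` in `N_{a-b}` with `f ∪ g ∈ X`. -/
abbrev N2 (X : Complex n) (a b : Finset (Fin (n + 1))) : Type :=
  {fg : N X a b × N X a b // fg.1.1 ∪ fg.2.1 ∈ X}

/-- The functions `λ` on `N_{a-b}` with `λ(f) = 0` for `f ∈ Ñ_{a-b}`, and `λ(f) = λ(g)` whenever
`f ∪ g ∈ X`. -/
def HomN (X : Complex n) (a b : Finset (Fin (n + 1))) : Submodule ℂ (N X a b → ℂ) where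
  carrier := {l | (∀ f : N X a b, f.1 ∈ NTilde X a b → l f = 0) ∧
    ∀ f g : N X a b, f.1 ∪ g.1 ∈ X → l f = l g}
  add_mem' h h' := ⟨fun f hf => by simp [h.1 f hf, h'.1 f hf],
    fun f g hfg => by simp [h.2 f g hfg, h'.2 f g hfg]⟩
  zero_mem' := ⟨fun _ _ => rfl, fun _ _ _ => rfl⟩
  smul_mem' z _ h := ⟨fun f hf => by simp [h.1 f hf], fun f g hfg => by simp [h.2 f g hfg]⟩

/-- The antisymmetric functions `λ` on `N^{(2)}_{a-b}` such that `λ(f, g) = 0` for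
`f, g ∈ Ñ_{a-b}`, and `λ(f, g) - λ(f, h) + λ(g, h) = 0` whenever `f ∪ g ∪ h ∈ X`. -/
def CocyclesN (X : Complex n) (a b : Finset (Fin (n + 1))) : Submodule ℂ (N2 X a b → ℂ) where
  carrier := {l |
    (∀ (f g : N X a b) (hfg : f.1 ∪ g.1 ∈ X) (hgf : g.1 ∪ f.1 ∈ X),
      l ⟨(f, g), hfg⟩ = -l ⟨(g, f), hgf⟩) ∧
    (∀ (f g : N X a b) (hfg : f.1 ∪ g.1 ∈ X), f.1 ∈ NTilde X a b → g.1 ∈ NTilde X a b →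
      l ⟨(f, g), hfg⟩ = 0) ∧
    (∀ (f g h : N X a b) (hfg : f.1 ∪ g.1 ∈ X) (hfh : f.1 ∪ h.1 ∈ X) (hgh : g.1 ∪ h.1 ∈ X),
      f.1 ∪ g.1 ∪ h.1 ∈ X →
      l ⟨(f, g), hfg⟩ - l ⟨(f, h), hfh⟩ + l ⟨(g, h), hgh⟩ = 0)}
  add_mem' {l m} h h' := by
    refine ⟨fun f g hfg hgf => ?_, fun f g hfg hf hg => ?_, fun f g k h1 h2 h3 hX => ?_⟩
    · simp only [Pi.add_apply]
      rw [h.1 f g hfg hgf, h'.1 f g hfg hgf]; ring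
    · simp only [Pi.add_apply]
      rw [h.2.1 f g hfg hf hg, h'.2.1 f g hfg hf hg, add_zero]
    · simp only [Pi.add_apply]
      linear_combination h.2.2 f g k h1 h2 h3 hX + h'.2.2 f g k h1 h2 h3 hX
  zero_mem' := by
    refine ⟨fun _ _ _ _ => ?_, fun _ _ _ _ _ => rfl, fun _ _ _ _ _ _ _ => ?_⟩ <;> simp
  smul_mem' z l h := by
    refine ⟨fun f g hfg hgf => ?_, fun f g hfg hf hg => ?_, fun f g k h1 h2 h3 hX => ?_⟩
    · simp only [Pi.smul_apply, smul_eq_mul]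
      rw [h.1 f g hfg hgf]; ring
    · simp only [Pi.smul_apply, smul_eq_mul]
      rw [h.2.1 f g hfg hf hg, mul_zero]
    · simp only [Pi.smul_apply, smul_eq_mul]
      linear_combination z * h.2.2 f g k h1 h2 h3 hX

/-- The coboundaries: the functions `(f, g) ↦ λ(f) - λ(g)` on `N^{(2)}_{a-b}`, where `λ` is a
function on `N_{a-b}` that vanishes on `Ñ_{a-b}`. -/
def CoboundariesN (X : Complex n) (a b : Finset (Fin (n + 1))) : Submodule ℂ (N2 X a b → ℂ) where
  carrier := {l | ∃ m : N X a b → ℂ, (∀ f : N X a b, f.1 ∈ NTilde X a b → m f = 0) ∧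
    ∀ fg : N2 X a b, l fg = m fg.1.1 - m fg.1.2}
  add_mem' := by
    rintro l l' ⟨m, h, e⟩ ⟨m', h', e'⟩
    exact ⟨m + m', fun f hf => by simp [h f hf, h' f hf], fun fg => by
      simp only [Pi.add_apply, e, e']; ring⟩
  zero_mem' := ⟨0, fun _ _ => rfl, fun _ => by simp⟩
  smul_mem' := by
    rintro z l ⟨m, h, e⟩
    exact ⟨z • m, fun f hf => by simp [h f hf], fun fg => by
      simp only [Pi.smul_apply, smul_eq_mul, e]; ring⟩

lemma coboundariesN_le (X : Complex n) (a b : Finset (Fin (n + 1))) :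
    CoboundariesN X a b ≤ CocyclesN X a b := by
  rintro l ⟨m, h, e⟩
  refine ⟨fun f g hfg hgf => ?_, fun f g hfg hf hg => ?_, fun f g k h1 h2 h3 hX => ?_⟩
  · rw [e, e]; ring
  · rw [e]; simp [h f hf, h g hg]
  · rw [e, e, e]; ring

/-- Cocycles modulo coboundaries. -/
abbrev T2N (X : Complex n) (a b : Finset (Fin (n + 1))) : Type :=
  CocyclesN X a b ⧸ (CoboundariesN X a b).submoduleOf (CocyclesN X a b)

/-- The map `Φ(p) = (p ∪ a) ∖ b` for `a`, `b` the supports of the positive and the negative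
part of `c`. -/
def Phi (c : Deg n) (p : Finset (Fin (n + 1))) : Finset (Fin (n + 1)) :=
  (p ∪ posSupp c) \ negSupp c

end

end StanleyReisner

/-! Each graded piece of `A_X` has dimension at most one: degree `u` is spanned by `x^u`, which is
nonzero exactly when `u ≥ 0` and the support of `u` is a face (`Alive`). A homogeneous homomorphism
is therefore a table of scalars indexed by generators, and the proof consists of finding which
tables occur.

For `c ≥ -1`, the monomial `x^{p+c}` survives in `A_X` iff `b ⊆ p` and `Φ(p) ∈ X`
(`alive_charVec_iff`). An entry of `c` below `-1` cannot be compensated by a square-free exponent,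
so then nothing survives. For a non-face `p`, `Φ(p) ∈ X` already implies `Φ(p) ∈ N_{a-b}`, and
`Ñ_{a-b}` is the set of those `Φ(p) ∈ X` coming from non-faces `p` that do not contain `b`
(`Phi_mem_NTilde`, `exists_subset_not_mem`).

For `Hom(I_X, A_X)`, the generators `x^p` and `x^q` divide the common monomial `x^{p ∪ q}`, so their
coefficients agree whenever `x^{(p ∪ q)+c}` survives (`homCoeff_eq`). Hence the coefficient depends
only on `Φ(p)`, is constant along pairs with `f ∪ g ∈ X`, and vanishes on `Ñ` because a generator
with `b ⊄ p` has coefficient zero. Conversely, such a function defines a homomorphism monomial by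
monomial (`homToN_surjective`). A derivation of degree `c` kills all variables if `b` has two
elements, and is a multiple of `x^{e_i+c} ∂_i` if `b = {i}`; the latter gives a constant function.

For `T²`, the module `R` is generated by the Taylor relations `R_{p,q}`, whose syzygies on triples
force the cocycle identity (`relCoeff_cocycle`). The Koszul relations force the coefficient to
vanish when neither `p` nor `q` contains `b` and `Φ(p ∪ q) ∈ X` (`relCoeff_eq_zero`). These two
conditions also suffice (`exists_relHom`), so cocycles on `N^{(2)}` map to `T²_c`. Homomorphisms
from the free module contribute exactly the coboundaries (`cocycleHom_mem_range_iff`), and every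
homogeneous homomorphism is a cocycle up to such a contribution, by comparison along a section of
`Φ` (`exists_sub_cocycleHom_mem`). -/

namespace StanleyReisner

noncomputable section

variable {n : ℕ}

/-! ## Monomials of `P` and of `A_X` -/

/-- An exponent vector as a multidegree. -/
def intDeg (v : Fin (n + 1) →₀ ℕ) : Deg n := fun i => (v i : ℤ)

/-- The exponent vector of the square-free monomial `x^p`. -/
def sqExp (p : Finset (Fin (n + 1))) : Fin (n + 1) →₀ ℕ :=
  Finsupp.equivFunOnFinite.symm fun i => if i ∈ p then 1 else 0

@[simp] lemma intDeg_apply (v : Fin (n + 1) →₀ ℕ) (i : Fin (n + 1)) : intDeg v i = (v i : ℤ) := rfl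

@[simp] lemma sqExp_apply (p : Finset (Fin (n + 1))) (i : Fin (n + 1)) :
    sqExp p i = if i ∈ p then 1 else 0 := rfl

@[simp] lemma charVec_apply (p : Finset (Fin (n + 1))) (i : Fin (n + 1)) :
    charVec p i = if i ∈ p then 1 else 0 := rfl

lemma intDeg_sqExp (p : Finset (Fin (n + 1))) : intDeg (sqExp p) = charVec p := by
  ext i; simp

lemma intDeg_add (v w : Fin (n + 1) →₀ ℕ) : intDeg (v + w) = intDeg v + intDeg w := by
  ext i; simp

lemma intDeg_injective : Function.Injective (intDeg (n := n)) := by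
  intro v w h
  ext i
  have := congrFun h i
  simpa using this

lemma support_sqExp (p : Finset (Fin (n + 1))) : (sqExp p).support = p := by
  ext i; simp

lemma sqExp_le_iff {p : Finset (Fin (n + 1))} {v : Fin (n + 1) →₀ ℕ} :
    sqExp p ≤ v ↔ p ⊆ v.support := by
  constructor
  · intro h i hi
    have := h i
    simp only [sqExp_apply, if_pos hi] at this
    simp; omega
  · intro h i
    by_cases hi : i ∈ p
    · have := h hi
      simp at this
      simp [hi]; omega
    · simp [hi]

lemma sqExp_add_of_disjoint {p q : Finset (Fin (n + 1))} (h : Disjoint p q) :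
    sqExp p + sqExp q = sqExp (p ∪ q) := by
  ext i
  have : i ∈ p → i ∉ q := fun hi => Finset.disjoint_left.1 h hi
  by_cases hp : i ∈ p <;> by_cases hq : i ∈ q <;> simp_all

lemma sqfree_eq_monomial (p : Finset (Fin (n + 1))) :
    sqfree p = MvPolynomial.monomial (sqExp p) (1 : ℂ) := by
  rw [MvPolynomial.monomial_eq, sqfree, map_one, one_mul, Finsupp.prod, support_sqExp]
  refine Finset.prod_congr rfl fun i hi => ?_
  simp [hi]

lemma weight_eq_intDeg (v : Fin (n + 1) →₀ ℕ) :
    Finsupp.weight (fun i => (Pi.single i 1 : Deg n)) v = intDeg v := by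
  ext j
  rw [Finsupp.weight_apply, Finsupp.sum_fintype _ _ (by simp)]
  simp [Finset.sum_apply, Pi.single_apply]

lemma mem_polyDeg {u : Deg n} {f : Poly n} :
    f ∈ polyDeg u ↔ ∀ v, f.coeff v ≠ 0 → intDeg v = u := by
  rw [polyDeg, MvPolynomial.mem_weightedHomogeneousSubmodule, MvPolynomial.IsWeightedHomogeneous]
  simp only [weight_eq_intDeg]

lemma monomial_mem_polyDeg (v : Fin (n + 1) →₀ ℕ) (k : ℂ) :
    MvPolynomial.monomial v k ∈ polyDeg (intDeg v) := by
  classical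
  rw [mem_polyDeg]
  intro w hw
  rw [MvPolynomial.coeff_monomial] at hw
  by_cases h : v = w
  · rw [h]
  · simp [h] at hw

lemma sqfree_mem_polyDeg (p : Finset (Fin (n + 1))) : sqfree p ∈ polyDeg (charVec p) := by
  rw [sqfree_eq_monomial, ← intDeg_sqExp]
  exact monomial_mem_polyDeg _ _

lemma zMonomial_intDeg (v : Fin (n + 1) →₀ ℕ) :
    zMonomial (intDeg v) = MvPolynomial.monomial v (1 : ℂ) := by
  rw [zMonomial, if_pos (fun i => by simp)]
  congr 2
  ext i
  simp

lemma zMonomial_of_not {u : Deg n} (h : ¬ ∀ i, 0 ≤ u i) : zMonomial u = 0 := if_neg h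

lemma exists_intDeg {u : Deg n} (h : ∀ i, 0 ≤ u i) : ∃ v, intDeg v = u :=
  ⟨Finsupp.equivFunOnFinite.symm fun i => (u i).toNat, by ext i; simp [h i]⟩

lemma zMonomial_mem_polyDeg (u : Deg n) : zMonomial u ∈ polyDeg u := by
  by_cases h : ∀ i, 0 ≤ u i
  · obtain ⟨v, rfl⟩ := exists_intDeg h
    rw [zMonomial_intDeg]
    exact monomial_mem_polyDeg _ _
  · rw [zMonomial_of_not h]
    exact Submodule.zero_mem _

lemma exists_eq_smul_zMonomial {u : Deg n} {f : Poly n} (hf : f ∈ polyDeg u) :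
    ∃ k : ℂ, f = k • zMonomial u := by
  classical
  rw [mem_polyDeg] at hf
  by_cases h : ∀ i, 0 ≤ u i
  · obtain ⟨v, rfl⟩ := exists_intDeg h
    refine ⟨f.coeff v, ?_⟩
    ext w
    rw [zMonomial_intDeg, MvPolynomial.coeff_smul, MvPolynomial.coeff_monomial]
    by_cases hw : v = w
    · simp [hw]
    · simp only [hw, if_false, smul_zero]
      by_contra h0
      exact hw (intDeg_injective (hf w h0)).symm
  · refine ⟨0, ?_⟩
    rw [zero_smul]
    ext w
    by_contra h0
    exact h fun i => by rw [← hf w h0]; simp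

lemma monomial_mul_zMonomial (v : Fin (n + 1) →₀ ℕ) {u : Deg n} (h : ∀ i, 0 ≤ u i) :
    MvPolynomial.monomial v (1 : ℂ) * zMonomial u = zMonomial (intDeg v + u) := by
  obtain ⟨w, rfl⟩ := exists_intDeg h
  rw [← intDeg_add, zMonomial_intDeg, zMonomial_intDeg, MvPolynomial.monomial_mul, one_mul]

lemma posSupp_intDeg (v : Fin (n + 1) →₀ ℕ) : posSupp (intDeg v) = v.support := by
  ext i
  simp [posSupp, Nat.pos_iff_ne_zero]

@[simp] lemma mem_posSupp {u : Deg n} {i : Fin (n + 1)} : i ∈ posSupp u ↔ 0 < u i := by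
  simp [posSupp]

@[simp] lemma mem_negSupp {u : Deg n} {i : Fin (n + 1)} : i ∈ negSupp u ↔ u i < 0 := by
  simp [negSupp]

/-- A monomial ideal is tested monomial by monomial, and `x^p` divides `x^v` iff `p` lies in the
support of `v`. As `X` is closed under subsets, some such `p` is a non-face iff the support itself
is. -/
lemma mem_ideal_iff (X : Complex n) {f : Poly n} :
    f ∈ ideal X ↔ ∀ v ∈ f.support, v.support ∉ X := by
  have h : {m : Poly n | ∃ p, p ∉ X ∧ m = sqfree p} =
      (fun v => MvPolynomial.monomial v (1 : ℂ)) '' (sqExp '' {p | p ∉ X}) := by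
    ext m
    simp only [Set.mem_ofPred_eq, Set.mem_image, exists_exists_and_eq_and, sqfree_eq_monomial]
    exact ⟨fun ⟨p, hp, e⟩ => ⟨p, hp, e.symm⟩, fun ⟨p, hp, e⟩ => ⟨p, hp, e.symm⟩⟩
  rw [ideal, h, MvPolynomial.mem_ideal_span_monomial_image]
  refine forall₂_congr fun v _ => ?_
  simp only [Set.mem_image, Set.mem_ofPred_eq, exists_exists_and_eq_and]
  exact ⟨fun ⟨p, hp, e⟩ hv => hp (X.lower (sqExp_le_iff.1 e) hv),
    fun hv => ⟨v.support, hv, sqExp_le_iff.2 subset_rfl⟩⟩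

lemma monomial_mem_ideal (X : Complex n) {v : Fin (n + 1) →₀ ℕ} (hv : v.support ∉ X) (k : ℂ) :
    MvPolynomial.monomial v k ∈ ideal X := by
  rw [mem_ideal_iff]
  intro w hw
  rw [Finset.mem_singleton.1 (MvPolynomial.support_monomial_subset hw)]
  exact hv

/-- The multidegree `u` is the degree of a nonzero monomial of `A_X`. -/
def Alive (X : Complex n) (u : Deg n) : Prop := (∀ i, 0 ≤ u i) ∧ posSupp u ∈ X

/-- The image of `x^u` in `A_X`. -/
def ringMon (X : Complex n) (u : Deg n) : SRing X := toRing X (zMonomial u)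

lemma ringMon_eq_zero {X : Complex n} {u : Deg n} (h : ¬ Alive X u) : ringMon X u = 0 := by
  by_cases hu : ∀ i, 0 ≤ u i
  · obtain ⟨v, rfl⟩ := exists_intDeg hu
    have hv : v.support ∉ X := fun hv => h ⟨hu, by rwa [posSupp_intDeg]⟩
    rw [ringMon, zMonomial_intDeg]
    exact (Submodule.Quotient.mk_eq_zero _).2 (monomial_mem_ideal X hv 1)
  · rw [ringMon, zMonomial_of_not hu, map_zero]

lemma ringMon_mem_ringDeg (X : Complex n) (u : Deg n) : ringMon X u ∈ ringDeg X u :=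
  Submodule.mem_map_of_mem (zMonomial_mem_polyDeg u)

lemma exists_eq_smul_ringMon {X : Complex n} {u : Deg n} {y : SRing X} (hy : y ∈ ringDeg X u) :
    ∃ k : ℂ, y = k • ringMon X u := by
  obtain ⟨f, hf, rfl⟩ := hy
  obtain ⟨k, rfl⟩ := exists_eq_smul_zMonomial hf
  exact ⟨k, rfl⟩

lemma monomial_smul_ringMon (X : Complex n) (v : Fin (n + 1) →₀ ℕ) {u : Deg n}
    (h : ∀ i, 0 ≤ u i) :
    MvPolynomial.monomial v (1 : ℂ) • ringMon X u = ringMon X (intDeg v + u) := by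
  rw [ringMon, ringMon, ← monomial_mul_zMonomial v h, ← smul_eq_mul, map_smul]

open Classical in
/-- The coefficient of the monomial `x^u`, as a function on `A_X`; it is zero unless `x^u ≠ 0` in
`A_X`. -/
def ringCoeff (X : Complex n) (u : Deg n) : SRing X →ₗ[ℂ] ℂ :=
  if h : Alive X u then
    (((ideal X).restrictScalars ℂ).liftQ
      (MvPolynomial.lcoeff ℂ (Finsupp.equivFunOnFinite.symm fun i => (u i).toNat)) (by
        intro f hf
        rw [LinearMap.mem_ker, MvPolynomial.lcoeff_apply]
        by_contra h0
        obtain ⟨v, rfl⟩ := exists_intDeg h.1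
        have e : Finsupp.equivFunOnFinite.symm (fun i => (intDeg v i).toNat) = v := by
          ext i; simp
        rw [e] at h0
        exact (mem_ideal_iff X).1 hf v (MvPolynomial.mem_support_iff.2 h0)
          (posSupp_intDeg v ▸ h.2))) ∘ₗ
      (Submodule.Quotient.restrictScalarsEquiv ℂ (ideal X)).symm.toLinearMap
  else 0

lemma ringCoeff_of_not {X : Complex n} {u : Deg n} (h : ¬ Alive X u) : ringCoeff X u = 0 :=
  dif_neg h

lemma ringCoeff_toRing {X : Complex n} {v : Fin (n + 1) →₀ ℕ} (h : Alive X (intDeg v))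
    (f : Poly n) : ringCoeff X (intDeg v) (toRing X f) = f.coeff v := by
  rw [ringCoeff, dif_pos h]
  have e : Finsupp.equivFunOnFinite.symm (fun i => (intDeg v i).toNat) = v := by
    ext i; simp
  change MvPolynomial.coeff (Finsupp.equivFunOnFinite.symm (fun i => (intDeg v i).toNat)) f = _
  rw [e]

lemma ringCoeff_ringMon {X : Complex n} {u : Deg n} (h : Alive X u) :
    ringCoeff X u (ringMon X u) = 1 := by
  classical
  obtain ⟨v, rfl⟩ := exists_intDeg h.1
  rw [ringMon, ringCoeff_toRing h, zMonomial_intDeg]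
  simp

lemma eq_ringCoeff_smul {X : Complex n} {u : Deg n} {y : SRing X} (hy : y ∈ ringDeg X u) :
    y = ringCoeff X u y • ringMon X u := by
  obtain ⟨k, rfl⟩ := exists_eq_smul_ringMon hy
  by_cases h : Alive X u
  · simp [ringCoeff_ringMon h]
  · simp [ringMon_eq_zero h]

lemma eq_zero_of_mem_ringDeg {X : Complex n} {u : Deg n} {y : SRing X} (hy : y ∈ ringDeg X u)
    (h : ¬ Alive X u) : y = 0 := by
  rw [eq_ringCoeff_smul hy, ringMon_eq_zero h, smul_zero]

/-- The exponent `u` may have negative entries: then `x^v` does not divide `x^{v+u}`, and both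
coefficients are zero. This case is what later forces coefficients to vanish. No homogeneity of `y`
is needed. -/
lemma ringCoeff_monomial_smul {X : Complex n} (v : Fin (n + 1) →₀ ℕ) {u : Deg n}
    (h : Alive X (intDeg v + u)) (y : SRing X) :
    ringCoeff X (intDeg v + u) (MvPolynomial.monomial v (1 : ℂ) • y) = ringCoeff X u y := by
  classical
  obtain ⟨f, rfl⟩ := Submodule.mkQ_surjective _ y
  rw [← map_smul, smul_eq_mul]
  by_cases hu : ∀ i, 0 ≤ u i
  · obtain ⟨w, rfl⟩ := exists_intDeg hu
    have hw : Alive X (intDeg w) := by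
      refine ⟨hu, X.lower ?_ h.2⟩
      intro i
      simp
      omega
    rw [ringCoeff_toRing hw, ← intDeg_add, ringCoeff_toRing (by rwa [intDeg_add])]
    rw [MvPolynomial.coeff_monomial_mul, one_mul]
  · obtain ⟨w, hw⟩ := exists_intDeg h.1
    rw [ringCoeff_of_not (fun h' => hu h'.1), ← hw, ringCoeff_toRing (by rwa [hw]),
      MvPolynomial.coeff_monomial_mul', if_neg]
    · rfl
    · intro hle
      refine hu fun i => ?_
      have h1 := congrFun hw i
      have h2 := hle i
      simp at h1
      omega

/-! ## The supports of shifted monomials -/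

lemma mem_Phi {c : Deg n} {p : Finset (Fin (n + 1))} {i : Fin (n + 1)} :
    i ∈ Phi c p ↔ (i ∈ p ∨ 0 < c i) ∧ 0 ≤ c i := by
  simp [Phi]

lemma Phi_union (c : Deg n) (p q : Finset (Fin (n + 1))) :
    Phi c (p ∪ q) = Phi c p ∪ Phi c q := by
  ext i
  simp only [mem_Phi, Finset.mem_union]
  tauto

lemma Phi_mono (c : Deg n) {p q : Finset (Fin (n + 1))} (h : p ⊆ q) : Phi c p ⊆ Phi c q := by
  intro i
  simp only [mem_Phi]
  exact fun ⟨h1, h2⟩ => ⟨h1.imp_left fun h' => h h', h2⟩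

/-- The essential point is `p ⊆ Φ(p) ∪ b`: a non-face inside `Φ(p) ∪ b` makes the latter a non-face.
-/
lemma Phi_mem_N {X : Complex n} {c : Deg n} {p : Finset (Fin (n + 1))} (hp : p ∉ X)
    (h : Phi c p ∈ X) : Phi c p ∈ N X (posSupp c) (negSupp c) := by
  refine ⟨h, fun i => ?_, ?_, fun h' => hp (X.lower (fun i hi => ?_) h')⟩
  · simp only [mem_posSupp, mem_Phi]
    exact fun hi => ⟨Or.inr hi, hi.le⟩
  · ext i
    simp only [Finset.mem_inter, mem_Phi, mem_negSupp, Finset.notMem_empty, iff_false]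
    rintro ⟨⟨-, h1⟩, h2⟩
    omega
  · simp only [Finset.mem_union, mem_Phi, mem_negSupp]
    by_cases hc : 0 ≤ c i
    · exact Or.inl ⟨Or.inl hi, hc⟩
    · exact Or.inr (not_le.1 hc)

/-- Already `p ⊆ Φ(p) ∪ (p ∩ b)`, and `p ∩ b` is a proper subset of `b`. -/
lemma Phi_mem_NTilde {X : Complex n} {c : Deg n} {p : Finset (Fin (n + 1))} (hp : p ∉ X)
    (h : Phi c p ∈ X) (hb : ¬ negSupp c ⊆ p) : Phi c p ∈ NTilde X (posSupp c) (negSupp c) := by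
  refine ⟨Phi_mem_N hp h, p ∩ negSupp c, ⟨Finset.inter_subset_right, fun h' => hb ?_⟩,
    fun h' => hp (X.lower (fun i hi => ?_) h')⟩
  · exact h'.trans Finset.inter_subset_left
  · simp only [Finset.mem_union, mem_Phi, Finset.mem_inter, mem_negSupp]
    by_cases hc : 0 ≤ c i
    · exact Or.inl ⟨Or.inl hi, hc⟩
    · exact Or.inr ⟨hi, not_le.1 hc⟩

lemma Phi_union_of_mem_N {X : Complex n} {c : Deg n} {f b' : Finset (Fin (n + 1))}
    (hf : f ∈ N X (posSupp c) (negSupp c)) (hb : b' ⊆ negSupp c) : Phi c (f ∪ b') = f := by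
  obtain ⟨-, ha, hd, -⟩ := hf
  ext i
  have h1 : i ∈ f → ¬ c i < 0 := fun hi hc => by
    have : i ∈ f ∩ negSupp c := Finset.mem_inter.2 ⟨hi, mem_negSupp.2 hc⟩
    rw [hd] at this
    exact Finset.notMem_empty _ this
  have h2 : 0 < c i → i ∈ f := fun hi => ha (mem_posSupp.2 hi)
  have h3 : i ∈ b' → c i < 0 := fun hi => mem_negSupp.1 (hb hi)
  simp only [mem_Phi, Finset.mem_union]
  constructor
  · rintro ⟨(hi | hi) | hi, hc⟩
    · exact hi
    · exact absurd (h3 hi) (not_lt.2 hc)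
    · exact h2 hi
  · exact fun hi => ⟨Or.inl (Or.inl hi), not_lt.1 (h1 hi)⟩

lemma Phi_subset_posSupp {c : Deg n} {p : Finset (Fin (n + 1))} {v : Fin (n + 1) →₀ ℕ}
    (hp : p ⊆ v.support) : Phi c p ⊆ posSupp (intDeg v + c) := by
  intro i
  simp only [mem_Phi, mem_posSupp, Pi.add_apply, intDeg_apply]
  rintro ⟨hi | hi, hc⟩
  · have := hp hi
    simp at this
    omega
  · omega

lemma Phi_mem_of_alive {X : Complex n} {c : Deg n} {p : Finset (Fin (n + 1))}
    {v : Fin (n + 1) →₀ ℕ} (h : Alive X (intDeg v + c)) (hp : p ⊆ v.support) : Phi c p ∈ X :=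
  X.lower (Phi_subset_posSupp hp) h.2

lemma nonneg_iff {c : Deg n} (hc : ∀ i, -1 ≤ c i) (v : Fin (n + 1) →₀ ℕ) :
    (∀ i, 0 ≤ (intDeg v + c) i) ↔ negSupp c ⊆ v.support := by
  simp only [Pi.add_apply, intDeg_apply]
  constructor
  · intro h i hi
    have := h i
    rw [mem_negSupp] at hi
    simp
    omega
  · intro h i
    by_cases hi : c i < 0
    · have h1 := h (mem_negSupp.2 hi)
      have h2 := hc i
      simp at h1
      omega
    · omega

lemma charVec_nonneg_iff {c : Deg n} (hc : ∀ i, -1 ≤ c i) (p : Finset (Fin (n + 1))) :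
    (∀ i, 0 ≤ (charVec p + c) i) ↔ negSupp c ⊆ p := by
  rw [← intDeg_sqExp, nonneg_iff hc, support_sqExp]

/-- On `b` every entry of `c` is exactly `-1`, so it cancels the entry `1` of `p`. Once `b ⊆ p`, the
support of `p + c` is therefore `Φ(p)`. -/
lemma alive_charVec_iff {X : Complex n} {c : Deg n} (hc : ∀ i, -1 ≤ c i)
    (p : Finset (Fin (n + 1))) :
    Alive X (charVec p + c) ↔ negSupp c ⊆ p ∧ Phi c p ∈ X := by
  rw [Alive, charVec_nonneg_iff hc]
  refine and_congr_right fun h => ?_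
  have e : posSupp (charVec p + c) = Phi c p := by
    ext i
    have h1 : c i < 0 → i ∈ p := fun hi => h (mem_negSupp.2 hi)
    have h2 := hc i
    simp only [mem_Phi, mem_posSupp, Pi.add_apply, charVec_apply]
    by_cases hi : i ∈ p
    · simp [hi]; omega
    · have : ¬ c i < 0 := fun h' => hi (h1 h')
      simp [hi]; omega
  rw [e]

lemma union_alive {X : Complex n} {c : Deg n} (hc : ∀ i, -1 ≤ c i) {f : Finset (Fin (n + 1))}
    (hf : f ∈ N X (posSupp c) (negSupp c)) : Alive X (charVec (f ∪ negSupp c) + c) := by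
  rw [alive_charVec_iff hc, Phi_union_of_mem_N hf subset_rfl]
  exact ⟨Finset.subset_union_right, hf.1⟩

lemma not_alive_charVec {c : Deg n} (hc : ¬ ∀ i, -1 ≤ c i) (X : Complex n)
    (p : Finset (Fin (n + 1))) : ¬ Alive X (charVec p + c) := by
  intro h
  refine hc fun i => ?_
  have := h.1 i
  by_cases hi : i ∈ p <;> simp [hi] at this <;> omega

/-! ## Linearity from monomials -/

/-- Allows a `P`-linear map on a submodule to be built by restricting a `ℂ`-linear map of the
ambient module that is defined on monomials and need not be `P`-linear there. -/
lemma map_smul_of_mem_span {X : Complex n} {M ι : Type*} [AddCommGroup M] [Module (Poly n) M]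
    [Module ℂ M] [IsScalarTower ℂ (Poly n) M] (g : ι → M) (y : ι → SRing X)
    (ψ : M →ₗ[ℂ] SRing X)
    (h : ∀ (v : Fin (n + 1) →₀ ℕ) i, ψ (MvPolynomial.monomial v (1 : ℂ) • g i) =
      MvPolynomial.monomial v (1 : ℂ) • y i) {m : M}
    (hm : m ∈ Submodule.span (Poly n) (Set.range g)) (f : Poly n) : ψ (f • m) = f • ψ m := by
  have key : ∀ (f : Poly n) i, ψ (f • g i) = f • y i := by
    intro f i
    induction f using MvPolynomial.induction_on' with
    | monomial v k =>
      have e : MvPolynomial.monomial v k = k • MvPolynomial.monomial v (1 : ℂ) := by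
        rw [MvPolynomial.smul_monomial, smul_eq_mul, mul_one]
      rw [e, smul_assoc, map_smul, h, smul_assoc]
    | add p q hp hq => rw [add_smul, map_add, hp, hq, add_smul]
  induction hm using Submodule.span_induction generalizing f with
  | mem x hx =>
    obtain ⟨i, rfl⟩ := hx
    have h1 := key 1 i
    rw [one_smul, one_smul] at h1
    rw [key, h1]
  | zero => simp
  | add x y _ _ hx hy => rw [smul_add, map_add, hx, hy, map_add, smul_add]
  | smul r x _ hx => rw [smul_smul, hx, hx, smul_smul]

lemma ideal_eq_span_range (X : Complex n) :
    ideal X = Submodule.span (Poly n) (Set.range fun p : NonFace X => sqfree p.1) := by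
  have h : {m : Poly n | ∃ p, p ∉ X ∧ m = sqfree p} =
      Set.range fun p : NonFace X => sqfree p.1 := by
    ext m
    constructor
    · rintro ⟨p, hp, rfl⟩
      exact ⟨⟨p, hp⟩, rfl⟩
    · rintro ⟨p, rfl⟩
      exact ⟨p.1, p.2, rfl⟩
  rw [ideal, h]

lemma span_range_gen (X : Complex n) :
    Submodule.span (Poly n) (Set.range (gen X)) = ⊤ := by
  refine Submodule.map_injective_of_injective (f := (ideal X).subtype)
    (Submodule.injective_subtype _) ?_
  rw [Submodule.map_span, Submodule.map_top, Submodule.range_subtype, ← Set.range_comp]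
  exact (ideal_eq_span_range X).symm

lemma hom_ext_gen {X : Complex n} {φ ψ : ideal X →ₗ[Poly n] SRing X}
    (h : ∀ p, φ (gen X p) = ψ (gen X p)) : φ = ψ :=
  LinearMap.ext_on (span_range_gen X) (by rintro _ ⟨p, rfl⟩; exact h p)

lemma gen_mem_idealDeg (X : Complex n) (p : NonFace X) : gen X p ∈ idealDeg X (charVec p.1) :=
  sqfree_mem_polyDeg p.1

lemma hom_gen_mem {X : Complex n} {c : Deg n} {φ : ideal X →ₗ[Poly n] SRing X}
    (hφ : φ ∈ HomDeg X c) (p : NonFace X) : φ (gen X p) ∈ ringDeg X (charVec p.1 + c) :=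
  hφ _ _ (gen_mem_idealDeg X p)

/-! ## The graded pieces of `Hom(I_X, A_X)` -/

theorem homDeg_eq_bot (X : Complex n) {c : Deg n} (hc : ¬ ∀ i, -1 ≤ c i) : HomDeg X c = ⊥ := by
  rw [eq_bot_iff]
  intro φ hφ
  rw [Submodule.mem_bot]
  refine hom_ext_gen fun p => ?_
  rw [eq_zero_of_mem_ringDeg (hom_gen_mem hφ p) (not_alive_charVec hc X p.1)]
  rfl

/-- The coefficient of `φ(x^p)` at `x^{p + c}`. -/
def homCoeff (X : Complex n) (c : Deg n) (p : NonFace X) :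
    (ideal X →ₗ[Poly n] SRing X) →ₗ[ℂ] ℂ :=
  ringCoeff X (charVec p.1 + c) ∘ₗ
    { toFun := fun φ => φ (gen X p)
      map_add' := fun _ _ => rfl
      map_smul' := fun _ _ => rfl }

lemma homCoeff_apply (X : Complex n) (c : Deg n) (p : NonFace X)
    (φ : ideal X →ₗ[Poly n] SRing X) :
    homCoeff X c p φ = ringCoeff X (charVec p.1 + c) (φ (gen X p)) := rfl

lemma monomial_smul_gen (X : Complex n) (p q : NonFace X) :
    MvPolynomial.monomial (sqExp (q.1 \ p.1)) (1 : ℂ) • gen X p =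
      MvPolynomial.monomial (sqExp (p.1 \ q.1)) (1 : ℂ) • gen X q := by
  refine Subtype.ext ?_
  rw [← sqfree_eq_monomial, ← sqfree_eq_monomial]
  change sqfree (q.1 \ p.1) * sqfree p.1 = sqfree (p.1 \ q.1) * sqfree q.1
  rw [sqfree_mul, sqfree_mul, Finset.union_comm]

lemma intDeg_sdiff_add (p q : Finset (Fin (n + 1))) (c : Deg n) :
    intDeg (sqExp (q \ p)) + (charVec p + c) = charVec (p ∪ q) + c := by
  rw [← intDeg_sqExp p, ← add_assoc, ← intDeg_add,
    sqExp_add_of_disjoint Finset.sdiff_disjoint, intDeg_sqExp, Finset.sdiff_union_self_eq_union,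
    Finset.union_comm]

/-- Both coefficients are read off at `x^{(p ∪ q)+c}` from the image of `x^{p ∪ q}`, a multiple of
both generators. -/
lemma homCoeff_eq {X : Complex n} {c : Deg n} (φ : ideal X →ₗ[Poly n] SRing X) (p q : NonFace X)
    (h : Alive X (charVec (p.1 ∪ q.1) + c)) : homCoeff X c p φ = homCoeff X c q φ := by
  have h1 := ringCoeff_monomial_smul (X := X) (sqExp (q.1 \ p.1)) (u := charVec p.1 + c)
    (by rwa [intDeg_sdiff_add]) (φ (gen X p))
  have h2 := ringCoeff_monomial_smul (X := X) (sqExp (p.1 \ q.1)) (u := charVec q.1 + c)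
    (by rwa [intDeg_sdiff_add, Finset.union_comm]) (φ (gen X q))
  rw [homCoeff_apply, homCoeff_apply, ← h1, ← h2, intDeg_sdiff_add, intDeg_sdiff_add,
    Finset.union_comm, ← map_smul, ← map_smul, monomial_smul_gen]

lemma homCoeff_of_not_subset {X : Complex n} {c : Deg n} (hc : ∀ i, -1 ≤ c i)
    (φ : ideal X →ₗ[Poly n] SRing X) (p : NonFace X) (h : ¬ negSupp c ⊆ p.1) :
    homCoeff X c p φ = 0 := by
  rw [homCoeff_apply, ringCoeff_of_not fun h' => h ((alive_charVec_iff hc _).1 h').1]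
  rfl

/-- The non-face `f ∪ b` for `f ∈ N_{a-b}`. -/
def fill {X : Complex n} {a b : Finset (Fin (n + 1))} (f : N X a b) : NonFace X :=
  ⟨f.1 ∪ b, f.2.2.2.2⟩

/-- The map `φ ↦ λ_φ` from `Hom(I_X, A_X)_c` to functions on `N_{a-b}`. -/
def homToN (X : Complex n) (c : Deg n) (hc : ∀ i, -1 ≤ c i) :
    HomDeg X c →ₗ[ℂ] HomN X (posSupp c) (negSupp c) :=
  LinearMap.codRestrict _
    ((LinearMap.pi fun f : N X (posSupp c) (negSupp c) => homCoeff X c (fill f)) ∘ₗ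
      (HomDeg X c).subtype) (by
    intro φ
    refine ⟨fun f hf => ?_, fun f g hfg => ?_⟩
    · obtain ⟨b', hb, hb'⟩ := hf.2
      have h1 : negSupp c ∩ f.1 = ∅ := by rw [Finset.inter_comm]; exact f.2.2.2.1
      have h2 : ¬ negSupp c ⊆ f.1 ∪ b' := fun h => hb.2 fun i hi => by
        rcases Finset.mem_union.1 (h hi) with h' | h'
        · have : i ∈ negSupp c ∩ f.1 := Finset.mem_inter.2 ⟨hi, h'⟩
          rw [h1] at this
          exact absurd this (Finset.notMem_empty _)
        · exact h'
      have h3 : (f.1 ∪ negSupp c) ∪ (f.1 ∪ b') = f.1 ∪ negSupp c :=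
        Finset.union_eq_left.2 (Finset.union_subset_union_right hb.1)
      rw [← homCoeff_of_not_subset hc φ.1 ⟨f.1 ∪ b', hb'⟩ h2]
      refine homCoeff_eq φ.1 (fill f) ⟨f.1 ∪ b', hb'⟩ ?_
      change Alive X (charVec ((f.1 ∪ negSupp c) ∪ (f.1 ∪ b')) + c)
      rw [h3]
      exact union_alive hc f.2
    · refine homCoeff_eq φ.1 (fill f) (fill g) ?_
      rw [alive_charVec_iff hc]
      refine ⟨fun i hi => Finset.mem_union_left _ (Finset.mem_union_right _ hi), ?_⟩
      change Phi c ((f.1 ∪ negSupp c) ∪ (g.1 ∪ negSupp c)) ∈ X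
      rwa [Phi_union, Phi_union_of_mem_N f.2 subset_rfl, Phi_union_of_mem_N g.2 subset_rfl])

lemma homToN_apply {X : Complex n} {c : Deg n} (hc : ∀ i, -1 ≤ c i) (φ : HomDeg X c)
    (f : N X (posSupp c) (negSupp c)) : (homToN X c hc φ).1 f = homCoeff X c (fill f) φ.1 := rfl

lemma hom_gen_eq {X : Complex n} {c : Deg n} (hc : ∀ i, -1 ≤ c i) (φ : HomDeg X c)
    (p : NonFace X) (hp : Phi c p.1 ∈ N X (posSupp c) (negSupp c)) :
    φ.1 (gen X p) = (homToN X c hc φ).1 ⟨Phi c p.1, hp⟩ • ringMon X (charVec p.1 + c) := by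
  have h := hom_gen_mem φ.2 p
  by_cases ha : Alive X (charVec p.1 + c)
  · rw [eq_ringCoeff_smul h, homToN_apply]
    congr 1
    refine homCoeff_eq φ.1 p (fill ⟨Phi c p.1, hp⟩) ?_
    have hb := ((alive_charVec_iff hc _).1 ha).1
    rw [alive_charVec_iff hc]
    refine ⟨fun i hi => Finset.mem_union_left _ (hb hi), ?_⟩
    change Phi c (p.1 ∪ (Phi c p.1 ∪ negSupp c)) ∈ X
    rw [Phi_union, Phi_union_of_mem_N hp subset_rfl, Finset.union_self]
    exact hp.1
  · rw [eq_zero_of_mem_ringDeg h ha, ringMon_eq_zero ha, smul_zero]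

lemma hom_gen_eq_zero {X : Complex n} {c : Deg n} (hc : ∀ i, -1 ≤ c i) (φ : HomDeg X c)
    (p : NonFace X) (hp : Phi c p.1 ∉ N X (posSupp c) (negSupp c)) : φ.1 (gen X p) = 0 :=
  eq_zero_of_mem_ringDeg (hom_gen_mem φ.2 p) fun ha =>
    hp (Phi_mem_N p.2 ((alive_charVec_iff hc _).1 ha).2)

lemma homToN_injective {X : Complex n} {c : Deg n} (hc : ∀ i, -1 ≤ c i) :
    Function.Injective (homToN X c hc) := by
  intro φ ψ h
  refine Subtype.ext (hom_ext_gen fun p => ?_)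
  by_cases hp : Phi c p.1 ∈ N X (posSupp c) (negSupp c)
  · rw [hom_gen_eq hc φ p hp, hom_gen_eq hc ψ p hp, h]
  · rw [hom_gen_eq_zero hc φ p hp, hom_gen_eq_zero hc ψ p hp]

open Classical in
/-- The function `p ↦ λ(Φ(p))`, extended by zero. -/
def pullN {X : Complex n} {c : Deg n} (l : N X (posSupp c) (negSupp c) → ℂ)
    (p : Finset (Fin (n + 1))) : ℂ :=
  if h : Phi c p ∈ N X (posSupp c) (negSupp c) then l ⟨Phi c p, h⟩ else 0

lemma pullN_of_mem {X : Complex n} {c : Deg n} (l : N X (posSupp c) (negSupp c) → ℂ)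
    {p : Finset (Fin (n + 1))} (h : Phi c p ∈ N X (posSupp c) (negSupp c)) :
    pullN l p = l ⟨Phi c p, h⟩ := dif_pos h

lemma homToN_surjective {X : Complex n} {c : Deg n} (hc : ∀ i, -1 ≤ c i) :
    Function.Surjective (homToN X c hc) := by
  intro l
  -- The intended homomorphism sends `x^v` to `λ(Φ(supp v)) x^{v+c}`. It is defined on all of `P`
  -- for convenience; `P`-linearity is established only on `I_X`.
  let ψ : Poly n →ₗ[ℂ] SRing X := (MvPolynomial.basisMonomials (Fin (n + 1)) ℂ).constr ℂ
    fun v => pullN l.1 v.support • ringMon X (intDeg v + c)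
  have hψ : ∀ v, ψ (MvPolynomial.monomial v 1) =
      pullN l.1 v.support • ringMon X (intDeg v + c) := by
    intro v
    have := (MvPolynomial.basisMonomials (Fin (n + 1)) ℂ).constr_basis ℂ
      (fun v => pullN l.1 v.support • ringMon X (intDeg v + c)) v
    rwa [MvPolynomial.coe_basisMonomials] at this
  have h1 : ∀ (v : Fin (n + 1) →₀ ℕ) (p : NonFace X), ψ (MvPolynomial.monomial v (1 : ℂ) • sqfree p.1) =
      MvPolynomial.monomial v (1 : ℂ) • (pullN l.1 p.1 • ringMon X (charVec p.1 + c)) := by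
    intro v p
    rw [sqfree_eq_monomial, smul_eq_mul, MvPolynomial.monomial_mul, one_mul, hψ,
      smul_comm (MvPolynomial.monomial v (1 : ℂ))]
    have hp : p.1 ⊆ (v + sqExp p.1).support := by
      rw [← sqExp_le_iff]; exact le_add_self
    have hnf : (v + sqExp p.1).support ∉ X := fun h => p.2 (X.lower hp h)
    by_cases ha : Alive X (intDeg (v + sqExp p.1) + c)
    · have e1 := Phi_mem_of_alive ha hp
      have e2 := Phi_mem_of_alive ha subset_rfl
      have e3 : pullN l.1 (v + sqExp p.1).support = pullN l.1 p.1 := by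
        rw [pullN_of_mem _ (Phi_mem_N p.2 e1), pullN_of_mem _ (Phi_mem_N hnf e2)]
        refine l.2.2 _ _ ?_
        change Phi c _ ∪ Phi c p.1 ∈ X
        rw [← Phi_union, Finset.union_eq_left.2 hp]
        exact e2
      rw [e3]
      -- If `b ⊄ p`, the right side is zero because `x^{p+c} = 0`, although `x^{v+p+c}` survives;
      -- the vanishing of `λ` on `Ñ` is what reconciles the two sides.
      by_cases hb : negSupp c ⊆ p.1
      · rw [monomial_smul_ringMon _ _ ((charVec_nonneg_iff hc _).2 hb), ← intDeg_sqExp,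
          ← add_assoc, ← intDeg_add]
      · rw [pullN_of_mem _ (Phi_mem_N p.2 e1), l.2.1 _ (Phi_mem_NTilde p.2 e1 hb), zero_smul,
          zero_smul]
    · rw [ringMon_eq_zero ha, smul_zero]
      by_cases hb : negSupp c ⊆ p.1
      · rw [monomial_smul_ringMon _ _ ((charVec_nonneg_iff hc _).2 hb), ← intDeg_sqExp,
          ← add_assoc, ← intDeg_add, ringMon_eq_zero ha, smul_zero]
      · rw [ringMon_eq_zero fun h' => hb ((alive_charVec_iff hc _).1 h').1, smul_zero, smul_zero]
  let φ : ideal X →ₗ[Poly n] SRing X :=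
    { toFun := fun f => ψ f.1
      map_add' := fun f g => map_add ψ f.1 g.1
      map_smul' := fun r f =>
        map_smul_of_mem_span _ _ ψ h1 ((ideal_eq_span_range X).le f.2) r }
  have hφ : φ ∈ HomDeg X c := by
    intro u f hf
    have hf' : f.1 ∈ polyDeg u := hf
    obtain ⟨k, hk⟩ := exists_eq_smul_zMonomial hf'
    change ψ f.1 ∈ _
    by_cases hu : ∀ i, 0 ≤ u i
    · obtain ⟨v, rfl⟩ := exists_intDeg hu
      rw [hk, map_smul, zMonomial_intDeg, hψ]
      exact Submodule.smul_mem _ _ (Submodule.smul_mem _ _ (ringMon_mem_ringDeg _ _))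
    · rw [hk, zMonomial_of_not hu, smul_zero, map_zero]
      exact Submodule.zero_mem _
  refine ⟨⟨φ, hφ⟩, Subtype.ext (funext fun f => ?_)⟩
  rw [homToN_apply, homCoeff_apply]
  have h2 : φ (gen X (fill f)) = pullN l.1 (f.1 ∪ negSupp c) •
      ringMon X (charVec (f.1 ∪ negSupp c) + c) := by
    change ψ (sqfree (f.1 ∪ negSupp c)) = _
    rw [sqfree_eq_monomial, hψ, support_sqExp, intDeg_sqExp]
  have h3 := Phi_union_of_mem_N f.2 (b' := negSupp c) subset_rfl
  rw [h2, map_smul]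
  change _ • ringCoeff X (charVec (f.1 ∪ negSupp c) + c) _ = _
  rw [ringCoeff_ringMon (union_alive hc f.2), smul_eq_mul, mul_one,
    pullN_of_mem _ (by rw [h3]; exact f.2)]
  exact congrArg l.1 (Subtype.ext h3)

/-- The isomorphism `φ ↦ λ_φ` of `Hom(I_X, A_X)_c` with the space of locally constant functions on
`N_{a-b}` vanishing on `Ñ_{a-b}`. -/
def homEquiv (X : Complex n) (c : Deg n) (hc : ∀ i, -1 ≤ c i) :
    HomDeg X c ≃ₗ[ℂ] HomN X (posSupp c) (negSupp c) :=
  LinearEquiv.ofBijective (homToN X c hc) ⟨homToN_injective hc, homToN_surjective hc⟩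

/-! ## Trivial deformations -/

lemma single_add_nonneg {c : Deg n} (hc : ∀ i, -1 ≤ c i) {i : Fin (n + 1)}
    (hi : negSupp c = {i}) (j : Fin (n + 1)) : 0 ≤ ((Pi.single i 1 : Deg n) + c) j := by
  have h1 := hc j
  have h2 : c j < 0 → j = i := fun h => by
    have := mem_negSupp.2 h
    rw [hi] at this
    exact Finset.mem_singleton.1 this
  by_cases h : j = i
  · subst h; simp; omega
  · simp [h]; by_contra h3; exact h (h2 (by omega))

lemma smul_pderiv_monomial {c : Deg n} (hc : ∀ i, -1 ≤ c i) {i : Fin (n + 1)}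
    (hi : negSupp c = {i}) (v : Fin (n + 1) →₀ ℕ) (k : ℂ) :
    ((k • zMonomial ((Pi.single i 1 : Deg n) + c)) • MvPolynomial.pderiv i)
        (MvPolynomial.monomial v (1 : ℂ)) =
      (k * v i) • zMonomial (intDeg v + c) := by
  rw [Derivation.smul_apply, MvPolynomial.pderiv_monomial, one_mul, smul_eq_mul]
  by_cases hv : v i = 0
  · simp [hv]
  · have e1 : MvPolynomial.monomial (v - Finsupp.single i 1) ((v i : ℕ) : ℂ) =
        ((v i : ℕ) : ℂ) • MvPolynomial.monomial (v - Finsupp.single i 1) (1 : ℂ) := by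
      rw [MvPolynomial.smul_monomial, smul_eq_mul, mul_one]
    have e2 : intDeg (v - Finsupp.single i 1) + ((Pi.single i 1 : Deg n) + c) =
        intDeg v + c := by
      ext j
      by_cases h : j = i
      · subst h
        simp
        omega
      · simp [h]
    rw [e1, smul_mul_smul_comm, mul_comm (zMonomial _),
      monomial_mul_zMonomial _ (single_add_nonneg hc hi), e2]

/-- On square-free monomials the factor from `∂_i` is `1` if `i ∈ p`; if `i ∉ p`, it is `0`, and so
is `x^{p+c}` by the convention on negative exponents. -/
lemma smul_pderiv_sqfree {c : Deg n} (hc : ∀ i, -1 ≤ c i) {i : Fin (n + 1)}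
    (hi : negSupp c = {i}) (p : Finset (Fin (n + 1))) (k : ℂ) :
    ((k • zMonomial ((Pi.single i 1 : Deg n) + c)) • MvPolynomial.pderiv i) (sqfree p) =
      k • zMonomial (charVec p + c) := by
  rw [sqfree_eq_monomial, smul_pderiv_monomial hc hi, intDeg_sqExp]
  by_cases h : i ∈ p
  · simp [h]
  · rw [zMonomial_of_not (fun h' => h ((charVec_nonneg_iff hc p).1 h' (by simp [hi])))]
    simp

lemma smul_pderiv_mem_DerDeg {c : Deg n} (hc : ∀ i, -1 ≤ c i) {i : Fin (n + 1)}
    (hi : negSupp c = {i}) (k : ℂ) :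
    (k • zMonomial ((Pi.single i 1 : Deg n) + c)) • MvPolynomial.pderiv i ∈ DerDeg c := by
  intro u f hf
  obtain ⟨r, rfl⟩ := exists_eq_smul_zMonomial hf
  rw [Derivation.map_smul]
  refine Submodule.smul_mem _ _ ?_
  by_cases hu : ∀ i, 0 ≤ u i
  · obtain ⟨v, rfl⟩ := exists_intDeg hu
    rw [zMonomial_intDeg, smul_pderiv_monomial hc hi]
    exact Submodule.smul_mem _ _ (zMonomial_mem_polyDeg _)
  · rw [zMonomial_of_not hu, map_zero]
    exact Submodule.zero_mem _

lemma X_mem_polyDeg (i : Fin (n + 1)) :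
    (MvPolynomial.X i : Poly n) ∈ polyDeg (Pi.single i 1) := by
  have e : intDeg (Finsupp.single i 1) = (Pi.single i 1 : Deg n) := by
    ext j
    by_cases h : j = i
    · subst h; simp
    · simp [h]
  rw [← e]
  exact monomial_mem_polyDeg _ _

/-- The degree `e_j + c` of `D x_j` is still negative at `i`. -/
lemma derivation_X_eq_zero {c : Deg n} {D : Derivation ℂ (Poly n) (Poly n)} (hD : D ∈ DerDeg c)
    {i j : Fin (n + 1)} (hi : c i < 0) (h : j ≠ i) : D (MvPolynomial.X j) = 0 := by
  obtain ⟨k, hk⟩ := exists_eq_smul_zMonomial (hD _ _ (X_mem_polyDeg j))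
  rw [hk, zMonomial_of_not, smul_zero]
  intro h0
  have := h0 i
  simp [h.symm] at this
  omega

lemma derivation_eq_smul_pderiv {c : Deg n} {D : Derivation ℂ (Poly n) (Poly n)}
    (hD : D ∈ DerDeg c) {i : Fin (n + 1)} (hi : c i < 0) :
    ∃ k : ℂ, D = (k • zMonomial ((Pi.single i 1 : Deg n) + c)) • MvPolynomial.pderiv i := by
  obtain ⟨k, hk⟩ := exists_eq_smul_zMonomial (hD _ _ (X_mem_polyDeg i))
  refine ⟨k, MvPolynomial.derivation_ext fun j => ?_⟩
  rw [Derivation.smul_apply]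
  by_cases h : j = i
  · subst h
    rw [hk, MvPolynomial.pderiv_X_self, smul_eq_mul, mul_one]
  · rw [derivation_X_eq_zero hD hi h, MvPolynomial.pderiv_X_of_ne (Ne.symm fun h' => h h'.symm),
      smul_zero]

lemma homCoeff_smul_pderiv {X : Complex n} {c : Deg n} (hc : ∀ i, -1 ≤ c i) {i : Fin (n + 1)}
    (hi : negSupp c = {i}) (k : ℂ) (f : N X (posSupp c) (negSupp c)) :
    homCoeff X c (fill f) (derToHom X
      ((k • zMonomial ((Pi.single i 1 : Deg n) + c)) • MvPolynomial.pderiv i)) = k := by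
  rw [homCoeff_apply]
  change ringCoeff X (charVec (f.1 ∪ negSupp c) + c) (toRing X
    (((k • zMonomial ((Pi.single i 1 : Deg n) + c)) • MvPolynomial.pderiv i)
      (sqfree (f.1 ∪ negSupp c)))) = k
  rw [smul_pderiv_sqfree hc hi]
  change ringCoeff X (charVec (f.1 ∪ negSupp c) + c)
    (k • ringMon X (charVec (f.1 ∪ negSupp c) + c)) = k
  rw [map_smul, ringCoeff_ringMon (union_alive hc f.2), smul_eq_mul, mul_one]

lemma derToHom_mem_HomDeg (X : Complex n) {c : Deg n} {D : Derivation ℂ (Poly n) (Poly n)}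
    (hD : D ∈ DerDeg c) : derToHom X D ∈ HomDeg X c :=
  fun u f hf => Submodule.mem_map_of_mem (hD u f.1 hf)

theorem mem_TrivialDeg_iff {X : Complex n} {c : Deg n} (hc : ∀ i, -1 ≤ c i) (φ : HomDeg X c) :
    φ.1 ∈ TrivialDeg X c ↔
      φ = 0 ∨ ((negSupp c).card = 1 ∧ ∃ k : ℂ, ∀ f, (homEquiv X c hc φ).1 f = k) := by
  constructor
  · rintro ⟨D, hD, hφ⟩
    replace hφ : derToHom X D = φ.1 := hφ
    by_cases hb : negSupp c = ∅
    -- With `b` empty, `N_{a-b}` is empty, since `f ∪ b = f` would be both a face and a non-face.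
    · refine Or.inl ((homEquiv X c hc).map_eq_zero_iff.1 (Subtype.ext (funext fun f => ?_)))
      have h := f.2.2.2.2
      have e : f.1 ∪ negSupp c = f.1 := Finset.union_eq_left.2 (by simp [hb])
      rw [e] at h
      exact absurd f.2.1 h
    obtain ⟨i, hi⟩ := Finset.nonempty_iff_ne_empty.2 hb
    by_cases h : negSupp c = {i}
    · right
      refine ⟨by rw [h, Finset.card_singleton], ?_⟩
      obtain ⟨k, rfl⟩ := derivation_eq_smul_pderiv hD (mem_negSupp.1 hi)
      refine ⟨k, fun f => ?_⟩
      change homCoeff X c (fill f) φ.1 = k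
      rw [← hφ, homCoeff_smul_pderiv hc h]
    · left
      obtain ⟨j, hj, hji⟩ : ∃ j ∈ negSupp c, j ≠ i := by
        by_contra! h'
        exact h (Finset.eq_singleton_iff_unique_mem.2 ⟨hi, h'⟩)
      -- Every variable differs from at least one of the two distinct elements `i`, `j` of `b`.
      have hD0 : D = 0 := MvPolynomial.derivation_ext fun k => by
        by_cases hk : k = i
        · subst hk
          exact derivation_X_eq_zero hD (mem_negSupp.1 hj) hji.symm
        · exact derivation_X_eq_zero hD (mem_negSupp.1 hi) hk
      rw [hD0, map_zero] at hφ
      exact Subtype.ext hφ.symm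
  · rintro (rfl | ⟨hb, k, hk⟩)
    · exact Submodule.zero_mem _
    · obtain ⟨i, hi⟩ := Finset.card_eq_one.1 hb
      have hD := smul_pderiv_mem_DerDeg hc hi k
      refine ⟨_, hD, ?_⟩
      have e : (⟨_, derToHom_mem_HomDeg X hD⟩ : HomDeg X c) = φ := by
        refine homToN_injective hc (Subtype.ext (funext fun f => ?_))
        rw [homToN_apply, homCoeff_smul_pderiv hc hi]
        exact (hk f).symm
      exact congrArg Subtype.val e

/-! ## The Taylor relations generate the relations -/

lemma free_eq_top {X : Complex n} (W : Submodule ℂ (Free X))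
    (h : ∀ (p : NonFace X) (v : Fin (n + 1) →₀ ℕ),
      (Pi.single p (MvPolynomial.monomial v (1 : ℂ)) : Free X) ∈ W) (y : Free X) : y ∈ W := by
  classical
  have h1 : ∀ (p : NonFace X) (f : Poly n), (Pi.single p f : Free X) ∈ W := by
    intro p f
    induction f using MvPolynomial.induction_on' with
    | monomial v k =>
      have e : MvPolynomial.monomial v k = k • MvPolynomial.monomial v (1 : ℂ) := by
        rw [MvPolynomial.smul_monomial, smul_eq_mul, mul_one]
      rw [e, Pi.single_smul]
      exact W.smul_mem _ (h p v)
    | add f g hf hg => rw [Pi.single_add]; exact W.add_mem hf hg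
  rw [← Finset.univ_sum_single y]
  exact W.sum_mem fun p _ => h1 p _

/-- The `ℂ`-linear map on the free module with prescribed values on the monomials `x^v e_p`. -/
def freeLift (X : Complex n) (y : NonFace X → (Fin (n + 1) →₀ ℕ) → SRing X) :
    Free X →ₗ[ℂ] SRing X :=
  ∑ p : NonFace X, (MvPolynomial.basisMonomials (Fin (n + 1)) ℂ).constr ℂ (y p) ∘ₗ
    (LinearMap.proj (R := Poly n) (φ := fun _ : NonFace X => Poly n) p).restrictScalars ℂ

lemma freeLift_single (X : Complex n) (y : NonFace X → (Fin (n + 1) →₀ ℕ) → SRing X)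
    (p : NonFace X) (v : Fin (n + 1) →₀ ℕ) :
    freeLift X y (Pi.single p (MvPolynomial.monomial v 1)) = y p v := by
  classical
  have h := (MvPolynomial.basisMonomials (Fin (n + 1)) ℂ).constr_basis ℂ (y p) v
  rw [MvPolynomial.coe_basisMonomials] at h
  rw [freeLift, LinearMap.sum_apply, Finset.sum_eq_single p]
  · simpa using h
  · intro q _ hq
    simp [Pi.single_eq_of_ne hq]
  · simp

lemma pres_single (X : Complex n) (p : NonFace X) (v : Fin (n + 1) →₀ ℕ) :
    pres X (Pi.single p (MvPolynomial.monomial v 1)) =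
      MvPolynomial.monomial (v + sqExp p.1) 1 := by
  rw [pres, Fintype.linearCombination_apply_single, sqfree_eq_monomial, smul_eq_mul,
    MvPolynomial.monomial_mul, one_mul]

lemma monomial_smul_single {X : Complex n} (p : NonFace X) (v w : Fin (n + 1) →₀ ℕ) :
    MvPolynomial.monomial v (1 : ℂ) •
      (Pi.single p (MvPolynomial.monomial w (1 : ℂ)) : Free X) =
      Pi.single p (MvPolynomial.monomial (v + w) 1) := by
  rw [← Pi.single_smul, smul_eq_mul, MvPolynomial.monomial_mul, one_mul]

lemma monomial_smul_taylorRel {X : Complex n} (p q : NonFace X) (w : Fin (n + 1) →₀ ℕ) :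
    MvPolynomial.monomial w (1 : ℂ) • (taylorRel X p q).1 =
      (Pi.single p (MvPolynomial.monomial (w + sqExp (q.1 \ p.1)) 1) : Free X) -
        Pi.single q (MvPolynomial.monomial (w + sqExp (p.1 \ q.1)) 1) := by
  rw [taylorRel, smul_sub, sqfree_eq_monomial, sqfree_eq_monomial, monomial_smul_single,
    monomial_smul_single]

lemma sqExp_sdiff_add (p q : Finset (Fin (n + 1))) :
    sqExp (q \ p) + sqExp p = sqExp (p ∪ q) := by
  rw [sqExp_add_of_disjoint Finset.sdiff_disjoint, Finset.sdiff_union_self_eq_union,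
    Finset.union_comm]

open Classical in
lemma rel_le_span_taylorRel (X : Complex n) :
    rel X ≤ Submodule.span (Poly n)
      (Set.range fun pq : NonFace X × NonFace X => (taylorRel X pq.1 pq.2).1) := by
  set S := Submodule.span (Poly n)
      (Set.range fun pq : NonFace X × NonFace X => (taylorRel X pq.1 pq.2).1)
  -- A normal form: lift `x^v` through the largest available generator, the one indexed by its full
  -- support. Then `y - T(j y)` is a combination of Taylor relations for every `y`, and `T(j r) = 0`
  -- for `r ∈ R`.
  let T : Poly n →ₗ[ℂ] Free X := (MvPolynomial.basisMonomials (Fin (n + 1)) ℂ).constr ℂ fun v =>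
    if h : v.support ∉ X then
      Pi.single ⟨v.support, h⟩ (MvPolynomial.monomial (v - sqExp v.support) 1)
    else 0
  have hT : ∀ (v : Fin (n + 1) →₀ ℕ) (h : v.support ∉ X), T (MvPolynomial.monomial v 1) =
      (Pi.single ⟨v.support, h⟩ (MvPolynomial.monomial (v - sqExp v.support) 1) : Free X) := by
    intro v h
    have := (MvPolynomial.basisMonomials (Fin (n + 1)) ℂ).constr_basis ℂ (fun v =>
      if h : v.support ∉ X then
        (Pi.single ⟨v.support, h⟩ (MvPolynomial.monomial (v - sqExp v.support) 1) : Free X)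
      else 0) v
    rw [MvPolynomial.coe_basisMonomials, dif_pos h] at this
    exact this
  have key : ∀ y, y ∈ (S.restrictScalars ℂ).comap
      (LinearMap.id - T ∘ₗ (pres X).restrictScalars ℂ) := by
    refine free_eq_top _ fun p v => ?_
    have hp : p.1 ⊆ (v + sqExp p.1).support := by rw [← sqExp_le_iff]; exact le_add_self
    have hs : (v + sqExp p.1).support ∉ X := fun h => p.2 (X.lower hp h)
    change Pi.single p (MvPolynomial.monomial v 1) -
      T (pres X (Pi.single p (MvPolynomial.monomial v 1))) ∈ S
    rw [pres_single, hT _ hs]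
    set s : NonFace X := ⟨(v + sqExp p.1).support, hs⟩ with hs_def
    have hle : sqExp s.1 ≤ v + sqExp p.1 := sqExp_le_iff.2 subset_rfl
    have e1 : v + sqExp p.1 - sqExp s.1 + sqExp (s.1 \ p.1) = v := by
      refine add_right_cancel (b := sqExp p.1) ?_
      rw [add_assoc, sqExp_sdiff_add, Finset.union_eq_right.2 hp, tsub_add_cancel_of_le hle]
    have e2 : v + sqExp p.1 - sqExp s.1 + sqExp (p.1 \ s.1) = v + sqExp p.1 - sqExp s.1 := by
      have : sqExp (p.1 \ s.1) = 0 := by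
        rw [Finset.sdiff_eq_empty_iff_subset.2 hp]; ext i; simp
      rw [this, add_zero]
    have e := monomial_smul_taylorRel p s (v + sqExp p.1 - sqExp s.1)
    rw [e1, e2] at e
    rw [← e]
    exact S.smul_mem _ (Submodule.subset_span ⟨(p, s), rfl⟩)
  intro r hr
  have h1 : r - T (pres X r) ∈ S := key r
  rwa [LinearMap.mem_ker.1 hr, map_zero, sub_zero] at h1

lemma span_taylorRel (X : Complex n) :
    Submodule.span (Poly n)
      (Set.range fun pq : NonFace X × NonFace X => taylorRel X pq.1 pq.2) = ⊤ := by
  refine Submodule.map_injective_of_injective (f := (rel X).subtype)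
    (Submodule.injective_subtype _) ?_
  rw [Submodule.map_span, Submodule.map_top, Submodule.range_subtype, ← Set.range_comp]
  refine le_antisymm (Submodule.span_le.2 ?_) (rel_le_span_taylorRel X)
  rintro _ ⟨pq, rfl⟩
  exact (taylorRel X pq.1 pq.2).2

lemma relHom_ext {X : Complex n} {φ ψ : RelMod X →ₗ[Poly n] SRing X}
    (h : ∀ p q, φ (toRelMod X (taylorRel X p q)) = ψ (toRelMod X (taylorRel X p q))) :
    φ = ψ := by
  refine Submodule.linearMap_qext _ (LinearMap.ext_on (span_taylorRel X) ?_)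
  rintro _ ⟨⟨p, q⟩, rfl⟩
  exact h p q

lemma mem_freeDeg {X : Complex n} {u : Deg n} {y : Free X} :
    y ∈ freeDeg X u ↔ ∀ p, y p ∈ polyDeg (u - charVec p.1) := by
  simp [freeDeg, Submodule.mem_iInf]

lemma single_mem_freeDeg {X : Complex n} {u : Deg n} (p : NonFace X) {f : Poly n}
    (hf : f ∈ polyDeg (u - charVec p.1)) : (Pi.single p f : Free X) ∈ freeDeg X u := by
  classical
  rw [mem_freeDeg]
  intro q
  by_cases h : q = p
  · subst h
    rwa [Pi.single_eq_same]
  · rw [Pi.single_eq_of_ne h]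
    exact Submodule.zero_mem _

lemma sqfree_sdiff_mem (p q : Finset (Fin (n + 1))) :
    sqfree (q \ p) ∈ polyDeg (charVec (p ∪ q) - charVec p) := by
  have e : charVec (p ∪ q) - charVec p = charVec (q \ p) := by
    rw [← intDeg_sqExp, ← intDeg_sqExp, ← intDeg_sqExp, ← sqExp_sdiff_add, intDeg_add,
      add_sub_cancel_right]
  rw [e]
  exact sqfree_mem_polyDeg _

lemma taylorRel_mem_freeDeg (X : Complex n) (p q : NonFace X) :
    (taylorRel X p q).1 ∈ freeDeg X (charVec (p.1 ∪ q.1)) := by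
  refine Submodule.sub_mem _ (single_mem_freeDeg p (sqfree_sdiff_mem _ _))
    (single_mem_freeDeg q ?_)
  rw [Finset.union_comm]
  exact sqfree_sdiff_mem _ _

lemma relHom_taylorRel_mem {X : Complex n} {c : Deg n} {φ : RelMod X →ₗ[Poly n] SRing X}
    (hφ : φ ∈ RelHomDeg X c) (p q : NonFace X) :
    φ (toRelMod X (taylorRel X p q)) ∈ ringDeg X (charVec (p.1 ∪ q.1) + c) :=
  hφ _ _ (Submodule.mem_map_of_mem (f := (toRelMod X).restrictScalars ℂ)
    (taylorRel_mem_freeDeg X p q))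

theorem relHomDeg_eq_bot (X : Complex n) {c : Deg n} (hc : ¬ ∀ i, -1 ≤ c i) :
    RelHomDeg X c = ⊥ := by
  rw [eq_bot_iff]
  intro φ hφ
  rw [Submodule.mem_bot]
  refine relHom_ext fun p q => ?_
  rw [eq_zero_of_mem_ringDeg (relHom_taylorRel_mem hφ p q) (not_alive_charVec hc X _)]
  rfl

/-! ## Homomorphisms from compatible coefficients -/

/-- The hypothesis `hm` makes the scalars compatible with the syzygies among Taylor relations; `hz`
handles the Koszul relations and the multiples of `R_{p,q}` whose degree survives while that of
`R_{p,q}` does not. -/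
theorem exists_relHom {X : Complex n} {c : Deg n} (hc : ∀ i, -1 ≤ c i)
    (m : NonFace X → NonFace X → ℂ)
    (hm : ∀ p q r : NonFace X, Phi c (p.1 ∪ q.1 ∪ r.1) ∈ X → m p q = m p r - m q r)
    (hz : ∀ p q : NonFace X, ¬ negSupp c ⊆ p.1 → ¬ negSupp c ⊆ q.1 →
      Phi c (p.1 ∪ q.1) ∈ X → m p q = 0) :
    ∃ φ ∈ RelHomDeg X c, ∀ p q : NonFace X,
      φ (toRelMod X (taylorRel X p q)) = m p q • ringMon X (charVec (p.1 ∪ q.1) + c) := by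
  classical
  have hsub : ∀ (v : Fin (n + 1) →₀ ℕ) (p : Finset (Fin (n + 1))),
      p ⊆ (v + sqExp p).support := fun v p => by rw [← sqExp_le_iff]; exact le_add_self
  have hnf : ∀ (p : NonFace X) (v : Fin (n + 1) →₀ ℕ), (v + sqExp p.1).support ∉ X :=
    fun p v h => p.2 (X.lower (hsub v p.1) h)
  -- Taking the support of the total degree as a common reference index makes a difference of two
  -- monomials of equal degree take the coefficient `m p q`, by `hm`.
  let ψ := freeLift X fun p v =>
    m p ⟨(v + sqExp p.1).support, hnf p v⟩ • ringMon X (intDeg (v + sqExp p.1) + c)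
  have hψ : ∀ (p : NonFace X) (v u : Fin (n + 1) →₀ ℕ) (h : v + sqExp p.1 = u)
      (hu : u.support ∉ X), ψ (Pi.single p (MvPolynomial.monomial v 1)) =
        m p ⟨u.support, hu⟩ • ringMon X (intDeg u + c) := by
    rintro p v u rfl hu
    exact freeLift_single X _ p v
  -- the difference of two monomials of the same degree
  have hdiff : ∀ (p q : NonFace X) (v w u : Fin (n + 1) →₀ ℕ), v + sqExp p.1 = u →
      w + sqExp q.1 = u → ψ (Pi.single p (MvPolynomial.monomial v 1)) -
        ψ (Pi.single q (MvPolynomial.monomial w 1)) = m p q • ringMon X (intDeg u + c) := by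
    intro p q v w u h1 h2
    have hp : p.1 ⊆ u.support := h1 ▸ hsub v p.1
    have hq : q.1 ⊆ u.support := h2 ▸ hsub w q.1
    have hu : u.support ∉ X := h1 ▸ hnf p v
    rw [hψ p v u h1 hu, hψ q w u h2 hu, ← sub_smul]
    by_cases ha : Alive X (intDeg u + c)
    · rw [hm p q ⟨u.support, hu⟩]
      rw [Finset.union_eq_right.2 (Finset.union_subset hp hq)]
      exact Phi_mem_of_alive ha subset_rfl
    · rw [ringMon_eq_zero ha, smul_zero, smul_zero]
  have hR : ∀ (w : Fin (n + 1) →₀ ℕ) (pq : NonFace X × NonFace X),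
      ψ (MvPolynomial.monomial w (1 : ℂ) • (taylorRel X pq.1 pq.2).1) =
        MvPolynomial.monomial w (1 : ℂ) •
          (m pq.1 pq.2 • ringMon X (charVec (pq.1.1 ∪ pq.2.1) + c)) := by
    rintro w ⟨p, q⟩
    dsimp only
    rw [monomial_smul_taylorRel, map_sub, hdiff p q _ _ (w + sqExp (p.1 ∪ q.1))
      (by rw [add_assoc, sqExp_sdiff_add])
      (by rw [add_assoc, sqExp_sdiff_add, Finset.union_comm]),
      smul_comm (MvPolynomial.monomial w (1 : ℂ))]
    by_cases hb : negSupp c ⊆ p.1 ∪ q.1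
    · rw [monomial_smul_ringMon _ _ ((charVec_nonneg_iff hc _).2 hb), ← intDeg_sqExp,
        ← add_assoc, ← intDeg_add]
    · rw [ringMon_eq_zero (u := charVec (p.1 ∪ q.1) + c)
        fun h' => hb ((alive_charVec_iff hc _).1 h').1, smul_zero, smul_zero]
      by_cases ha : Alive X (intDeg (w + sqExp (p.1 ∪ q.1)) + c)
      · rw [hz p q (fun h => hb (h.trans Finset.subset_union_left))
          (fun h => hb (h.trans Finset.subset_union_right))
          (Phi_mem_of_alive ha (hsub w _)), zero_smul]
      · rw [ringMon_eq_zero ha, smul_zero]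
  have hK : ∀ e f : Free X, ψ (pres X f • e - pres X e • f) = 0 := by
    intro e f
    -- The Koszul expression is `ℂ`-bilinear in `e`, `f`, so it suffices to treat monomial multiples
    -- of basis vectors.
    let B : Free X →ₗ[ℂ] Free X →ₗ[ℂ] SRing X :=
      LinearMap.mk₂ ℂ (fun e f => ψ (pres X f • e - pres X e • f))
        (fun e e' f => by
          rw [← map_add]
          congr 1
          rw [smul_add, map_add, add_smul]
          abel)
        (fun k e f => by
          rw [← map_smul]
          congr 1
          rw [smul_sub, LinearMap.map_smul_of_tower, smul_assoc, smul_comm (pres X f) k e])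
        (fun e f f' => by
          rw [← map_add]
          congr 1
          rw [smul_add, map_add, add_smul]
          abel)
        (fun k e f => by
          rw [← map_smul]
          congr 1
          rw [smul_sub, LinearMap.map_smul_of_tower, smul_assoc, smul_comm k (pres X e) f])
    change B e f = 0
    suffices h : e ∈ LinearMap.ker B by rw [LinearMap.mem_ker.1 h]; rfl
    refine free_eq_top _ (fun p v => ?_) e
    rw [LinearMap.mem_ker]
    refine LinearMap.ext fun f => ?_
    change f ∈ LinearMap.ker (B _)
    refine free_eq_top _ (fun q w => ?_) f
    rw [LinearMap.mem_ker]
    change ψ (pres X (Pi.single q (MvPolynomial.monomial w 1)) •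
      Pi.single p (MvPolynomial.monomial v 1) -
      pres X (Pi.single p (MvPolynomial.monomial v 1)) •
        Pi.single q (MvPolynomial.monomial w 1)) = 0
    rw [pres_single, pres_single, monomial_smul_single, monomial_smul_single, map_sub,
      hdiff p q _ _ (v + w + sqExp p.1 + sqExp q.1) (by abel) (by abel)]
    set u := v + w + sqExp p.1 + sqExp q.1 with hu
    by_cases ha : Alive X (intDeg u + c)
    -- If `b ⊆ s`, then `u` is at least `2` on `b ∩ t` and at least `1` on the rest of `t`, so `u +
    -- c` is positive on all of `t`. This would make `t` a face.
    · have hdead : ∀ s t : NonFace X, sqExp s.1 + sqExp t.1 ≤ u → ¬ negSupp c ⊆ s.1 := by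
        intro s t hle hb
        refine t.2 (X.lower (fun i hi => ?_) ha.2)
        have h1 := hle i
        have h2 := hc i
        simp only [Finsupp.add_apply, sqExp_apply, if_pos hi] at h1
        rw [mem_posSupp, Pi.add_apply, intDeg_apply]
        by_cases hi' : c i < 0
        · rw [if_pos (hb (mem_negSupp.2 hi'))] at h1
          omega
        · omega
      rw [hz p q (hdead p q ?_) (hdead q p ?_) (Phi_mem_of_alive ha ?_), zero_smul]
      · rw [hu, add_assoc]; exact le_add_self
      · rw [hu, add_assoc, add_comm (sqExp q.1)]; exact le_add_self
      · refine Finset.union_subset ?_ ?_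
        · rw [hu, add_right_comm]; exact hsub _ _
        · exact hsub _ _
    · rw [ringMon_eq_zero ha, smul_zero]
  let φ₀ : rel X →ₗ[Poly n] SRing X :=
    { toFun := fun r => ψ r.1
      map_add' := fun r s => map_add ψ r.1 s.1
      map_smul' := fun f r => map_smul_of_mem_span _ _ ψ hR (rel_le_span_taylorRel X r.2) f }
  have hker : (koszul X).submoduleOf (rel X) ≤ LinearMap.ker φ₀ := by
    have h : koszul X ≤ (LinearMap.ker φ₀).map (rel X).subtype := by
      refine Submodule.span_le.2 ?_
      rintro _ ⟨e, f, rfl⟩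
      exact ⟨⟨_, koszul_le_rel X (Submodule.subset_span ⟨e, f, rfl⟩)⟩, hK e f, rfl⟩
    intro r hr
    obtain ⟨s, hs, e⟩ := h hr
    rwa [← Subtype.ext e]
  refine ⟨((koszul X).submoduleOf (rel X)).liftQ φ₀ hker, ?_, ?_⟩
  · rintro u _ ⟨r, hr, rfl⟩
    change ψ r.1 ∈ _
    have hr' : r.1 ∈ freeDeg X u := hr
    rw [mem_freeDeg] at hr'
    rw [← Finset.univ_sum_single r.1, map_sum]
    refine Submodule.sum_mem _ fun p _ => ?_
    obtain ⟨k, hk⟩ := exists_eq_smul_zMonomial (hr' p)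
    rw [hk, Pi.single_smul, map_smul]
    refine Submodule.smul_mem _ _ ?_
    by_cases hu : ∀ i, 0 ≤ (u - charVec p.1) i
    · obtain ⟨v, hv⟩ := exists_intDeg hu
      rw [← hv, zMonomial_intDeg, hψ p v _ rfl (hnf p v), intDeg_add, hv, intDeg_sqExp,
        sub_add_cancel]
      exact Submodule.smul_mem _ _ (ringMon_mem_ringDeg _ _)
    · rw [zMonomial_of_not hu, Pi.single_zero, map_zero]
      exact Submodule.zero_mem _
  · intro p q
    have h := hR 0 (p, q)
    rw [MvPolynomial.monomial_zero', map_one, one_smul, one_smul] at h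
    exact h

/-! ## The coefficients of a homomorphism on the Taylor relations -/

/-- The coefficient of `φ(R_{p,q})` at `x^{(p ∪ q) + c}`. -/
def relCoeff (X : Complex n) (c : Deg n) (φ : RelMod X →ₗ[Poly n] SRing X) (p q : NonFace X) :
    ℂ :=
  ringCoeff X (charVec (p.1 ∪ q.1) + c) (φ (toRelMod X (taylorRel X p q)))

lemma relCoeff_of_not_subset {X : Complex n} {c : Deg n} (hc : ∀ i, -1 ≤ c i)
    (φ : RelMod X →ₗ[Poly n] SRing X) (p q : NonFace X) (h : ¬ negSupp c ⊆ p.1 ∪ q.1) :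
    relCoeff X c φ p q = 0 := by
  rw [relCoeff, ringCoeff_of_not fun h' => h ((alive_charVec_iff hc _).1 h').1]
  rfl

lemma relCoeff_of_alive {X : Complex n} {c : Deg n} {φ : RelMod X →ₗ[Poly n] SRing X}
    {p q : NonFace X} {k : ℂ} (h : Alive X (charVec (p.1 ∪ q.1) + c))
    (hφ : φ (toRelMod X (taylorRel X p q)) = k • ringMon X (charVec (p.1 ∪ q.1) + c)) :
    relCoeff X c φ p q = k := by
  rw [relCoeff, hφ, map_smul, ringCoeff_ringMon h, smul_eq_mul, mul_one]

lemma relHom_taylorRel {X : Complex n} {c : Deg n} {φ : RelMod X →ₗ[Poly n] SRing X}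
    (hφ : φ ∈ RelHomDeg X c) (p q : NonFace X) :
    φ (toRelMod X (taylorRel X p q)) =
      relCoeff X c φ p q • ringMon X (charVec (p.1 ∪ q.1) + c) :=
  eq_ringCoeff_smul (relHom_taylorRel_mem hφ p q)

lemma ringCoeff_monomial_smul_taylorRel {X : Complex n} {c : Deg n}
    (φ : RelMod X →ₗ[Poly n] SRing X) (p q : NonFace X) (s : Finset (Fin (n + 1)))
    (hs : p.1 ∪ q.1 ⊆ s) (h : Alive X (charVec s + c)) :
    ringCoeff X (charVec s + c) (φ (toRelMod X
      (MvPolynomial.monomial (sqExp (s \ (p.1 ∪ q.1))) (1 : ℂ) • taylorRel X p q))) =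
      relCoeff X c φ p q := by
  have e := intDeg_sdiff_add (p.1 ∪ q.1) s c
  rw [Finset.union_eq_right.2 hs] at e
  rw [map_smul, map_smul, ← e, ringCoeff_monomial_smul _ (by rwa [e])]
  rfl

/-- Raised to degree `s`, each relation becomes `x^{s∖p} e_p - x^{s∖q} e_q`, and these differences
telescope. -/
lemma taylorRel_cocycle {X : Complex n} (p q r : NonFace X) (s : Finset (Fin (n + 1)))
    (hs : s = p.1 ∪ q.1 ∪ r.1) :
    MvPolynomial.monomial (sqExp (s \ (p.1 ∪ q.1))) (1 : ℂ) • taylorRel X p q =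
      MvPolynomial.monomial (sqExp (s \ (p.1 ∪ r.1))) (1 : ℂ) • taylorRel X p r -
        MvPolynomial.monomial (sqExp (s \ (q.1 ∪ r.1))) (1 : ℂ) • taylorRel X q r := by
  have key : ∀ t u : Finset (Fin (n + 1)), t ∪ u ⊆ s →
      sqExp (s \ (t ∪ u)) + sqExp (u \ t) = sqExp (s \ t) := by
    intro t u h
    rw [sqExp_add_of_disjoint]
    · congr 1
      ext i
      have := @h i
      simp only [Finset.mem_union, Finset.mem_sdiff] at this ⊢
      tauto
    · refine Finset.disjoint_left.2 fun i => ?_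
      simp only [Finset.mem_union, Finset.mem_sdiff]
      tauto
  have key' : ∀ t u : Finset (Fin (n + 1)), t ∪ u ⊆ s →
      sqExp (s \ (t ∪ u)) + sqExp (t \ u) = sqExp (s \ u) := by
    intro t u h
    rw [Finset.union_comm]
    exact key u t (by rwa [Finset.union_comm])
  have h1 : p.1 ∪ q.1 ⊆ s := hs ▸ Finset.subset_union_left
  have h2 : p.1 ∪ r.1 ⊆ s := hs ▸ Finset.union_subset_union_left Finset.subset_union_left
  have h3 : q.1 ∪ r.1 ⊆ s := hs ▸ Finset.union_subset_union_left Finset.subset_union_right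
  refine Subtype.ext ?_
  change MvPolynomial.monomial _ (1 : ℂ) • (taylorRel X p q).1 =
    MvPolynomial.monomial _ (1 : ℂ) • (taylorRel X p r).1 -
      MvPolynomial.monomial _ (1 : ℂ) • (taylorRel X q r).1
  simp only [monomial_smul_taylorRel]
  rw [key _ _ h1, key' _ _ h1, key _ _ h2, key' _ _ h2, key _ _ h3, key' _ _ h3]
  abel

lemma relCoeff_cocycle {X : Complex n} {c : Deg n} (hc : ∀ i, -1 ≤ c i)
    (φ : RelMod X →ₗ[Poly n] SRing X) (p q r : NonFace X)
    (h : Phi c (p.1 ∪ q.1 ∪ r.1) ∈ X) :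
    relCoeff X c φ p q = relCoeff X c φ p r - relCoeff X c φ q r := by
  have h1 : p.1 ∪ q.1 ⊆ p.1 ∪ q.1 ∪ r.1 := Finset.subset_union_left
  have h2 : p.1 ∪ r.1 ⊆ p.1 ∪ q.1 ∪ r.1 :=
    Finset.union_subset_union_left Finset.subset_union_left
  have h3 : q.1 ∪ r.1 ⊆ p.1 ∪ q.1 ∪ r.1 :=
    Finset.union_subset_union_left Finset.subset_union_right
  by_cases hb : negSupp c ⊆ p.1 ∪ q.1 ∪ r.1
  · have ha := (alive_charVec_iff hc _).2 ⟨hb, h⟩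
    rw [← ringCoeff_monomial_smul_taylorRel φ p q _ h1 ha,
      ← ringCoeff_monomial_smul_taylorRel φ p r _ h2 ha,
      ← ringCoeff_monomial_smul_taylorRel φ q r _ h3 ha,
      taylorRel_cocycle p q r _ rfl, map_sub, map_sub, map_sub]
  · rw [relCoeff_of_not_subset hc φ p q fun h' => hb (h'.trans h1),
      relCoeff_of_not_subset hc φ p r fun h' => hb (h'.trans h2),
      relCoeff_of_not_subset hc φ q r fun h' => hb (h'.trans h3), sub_zero]

/-- The multiple equals `x^q e_p - x^p e_q`, the Koszul relation of the two basis vectors. -/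
lemma monomial_smul_taylorRel_mem_koszul {X : Complex n} (p q : NonFace X) :
    MvPolynomial.monomial (sqExp (p.1 ∩ q.1)) (1 : ℂ) • (taylorRel X p q).1 ∈ koszul X := by
  have key : ∀ s t : Finset (Fin (n + 1)), sqExp (s ∩ t) + sqExp (t \ s) = sqExp t := by
    intro s t
    rw [sqExp_add_of_disjoint]
    · congr 1
      ext i
      simp only [Finset.mem_union, Finset.mem_sdiff, Finset.mem_inter]
      tauto
    · refine Finset.disjoint_left.2 fun i => ?_
      simp only [Finset.mem_sdiff, Finset.mem_inter]
      tauto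
  have key' : sqExp (p.1 ∩ q.1) + sqExp (p.1 \ q.1) = sqExp p.1 := by
    rw [Finset.inter_comm]
    exact key _ _
  refine Submodule.subset_span ⟨Pi.single p (MvPolynomial.monomial 0 1),
    Pi.single q (MvPolynomial.monomial 0 1), ?_⟩
  rw [monomial_smul_taylorRel, key, key', pres_single, pres_single, monomial_smul_single,
    monomial_smul_single, zero_add, zero_add, add_zero, add_zero]

lemma relCoeff_eq_zero {X : Complex n} {c : Deg n} (hc : ∀ i, -1 ≤ c i)
    (φ : RelMod X →ₗ[Poly n] SRing X) (p q : NonFace X) (hp : ¬ negSupp c ⊆ p.1)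
    (hq : ¬ negSupp c ⊆ q.1) (h : Phi c (p.1 ∪ q.1) ∈ X) : relCoeff X c φ p q = 0 := by
  by_cases hb : negSupp c ⊆ p.1 ∪ q.1
  swap
  · exact relCoeff_of_not_subset hc φ p q hb
  -- This set is the support of `(p ∩ q) + (p ∪ q) + c`. If it is a face, multiplication by `x^{p ∩
  -- q}` preserves the coefficient and lands in `R₀`. Otherwise it is a non-face `r`, and the
  -- cocycle identity reduces the claim to the pairs `(p, r)` and `(q, r)`, neither of whose unions
  -- contains `b`.
  by_cases hr : Phi c (p.1 ∪ q.1) ∪ (p.1 ∩ q.1 ∩ negSupp c) ∈ X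
  · have hmem : toRelMod X
        (MvPolynomial.monomial (sqExp (p.1 ∩ q.1)) (1 : ℂ) • taylorRel X p q) = 0 :=
      (Submodule.Quotient.mk_eq_zero _).2 (monomial_smul_taylorRel_mem_koszul p q)
    have ha : Alive X (intDeg (sqExp (p.1 ∩ q.1)) + (charVec (p.1 ∪ q.1) + c)) := by
      have h0 := (charVec_nonneg_iff hc _).2 hb
      refine ⟨fun i => add_nonneg (Int.natCast_nonneg _) (h0 i), X.lower (fun i hi => ?_) hr⟩
      rw [mem_posSupp] at hi
      have h1 := hc i
      simp only [Finset.mem_union, mem_Phi, Finset.mem_inter, mem_negSupp]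
      simp only [Pi.add_apply, intDeg_apply, sqExp_apply, charVec_apply, Finset.mem_inter,
        Finset.mem_union] at hi
      by_cases h2 : i ∈ p.1 <;> by_cases h3 : i ∈ q.1 <;> simp [h2, h3] at hi ⊢ <;> omega
    have e := ringCoeff_monomial_smul _ ha (φ (toRelMod X (taylorRel X p q)))
    rw [← map_smul, ← map_smul, hmem, map_zero, map_zero] at e
    exact e.symm
  · have hN : Phi c (p.1 ∪ q.1) ∈ N X (posSupp c) (negSupp c) :=
      Phi_mem_N (fun h' => p.2 (X.lower Finset.subset_union_left h')) h
    have hsub : ∀ s : Finset (Fin (n + 1)), ¬ negSupp c ⊆ s → p.1 ∩ q.1 ⊆ s →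
        ¬ negSupp c ⊆ s ∪ (Phi c (p.1 ∪ q.1) ∪ (p.1 ∩ q.1 ∩ negSupp c)) := by
      refine fun s hs hpq h' => hs fun i hi => ?_
      have h1 := h' hi
      rw [mem_negSupp] at hi
      simp only [Finset.mem_union, mem_Phi, Finset.mem_inter] at h1
      rcases h1 with h1 | h1 | h1
      · exact h1
      · omega
      · exact hpq (Finset.mem_inter.2 h1.1)
    rw [relCoeff_cocycle hc φ p q ⟨_, hr⟩, relCoeff_of_not_subset hc φ p ⟨_, hr⟩,
      relCoeff_of_not_subset hc φ q ⟨_, hr⟩, sub_zero]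
    · exact hsub _ hq Finset.inter_subset_right
    · exact hsub _ hp Finset.inter_subset_left
    · rw [Phi_union, Phi_union_of_mem_N hN Finset.inter_subset_right, Finset.union_self]
      exact h

/-! ## Homomorphisms from cocycles -/

open Classical in
/-- The function `(p, q) ↦ λ(Φ(p), Φ(q))`, extended by zero. -/
def pullN2 {X : Complex n} {c : Deg n} (l : N2 X (posSupp c) (negSupp c) → ℂ)
    (p q : NonFace X) : ℂ :=
  if h : Phi c p.1 ∈ N X (posSupp c) (negSupp c) ∧ Phi c q.1 ∈ N X (posSupp c) (negSupp c) ∧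
      Phi c p.1 ∪ Phi c q.1 ∈ X then
    l ⟨(⟨Phi c p.1, h.1⟩, ⟨Phi c q.1, h.2.1⟩), h.2.2⟩
  else 0

lemma pullN2_of_mem {X : Complex n} {c : Deg n} (l : N2 X (posSupp c) (negSupp c) → ℂ)
    {p q : NonFace X} (hp : Phi c p.1 ∈ N X (posSupp c) (negSupp c))
    (hq : Phi c q.1 ∈ N X (posSupp c) (negSupp c)) (h : Phi c p.1 ∪ Phi c q.1 ∈ X) :
    pullN2 l p q = l ⟨(⟨Phi c p.1, hp⟩, ⟨Phi c q.1, hq⟩), h⟩ := dif_pos ⟨hp, hq, h⟩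

lemma Phi_mem_N_left {X : Complex n} {c : Deg n} {p q : NonFace X}
    (h : Phi c (p.1 ∪ q.1) ∈ X) : Phi c p.1 ∈ N X (posSupp c) (negSupp c) :=
  Phi_mem_N p.2 (X.lower (Phi_mono c Finset.subset_union_left) h)

lemma Phi_mem_N_right {X : Complex n} {c : Deg n} {p q : NonFace X}
    (h : Phi c (p.1 ∪ q.1) ∈ X) : Phi c q.1 ∈ N X (posSupp c) (negSupp c) :=
  Phi_mem_N q.2 (X.lower (Phi_mono c Finset.subset_union_right) h)

lemma pullN2_eq {X : Complex n} {c : Deg n} (l : N2 X (posSupp c) (negSupp c) → ℂ)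
    {p q : NonFace X} (h : Phi c (p.1 ∪ q.1) ∈ X) :
    pullN2 l p q = l ⟨(⟨Phi c p.1, Phi_mem_N_left h⟩, ⟨Phi c q.1, Phi_mem_N_right h⟩),
      Phi_union c p.1 q.1 ▸ h⟩ := pullN2_of_mem l _ _ _

lemma pullN2_cocycle {X : Complex n} {c : Deg n} (l : CocyclesN X (posSupp c) (negSupp c))
    (p q r : NonFace X) (h : Phi c (p.1 ∪ q.1 ∪ r.1) ∈ X) :
    pullN2 l.1 p q = pullN2 l.1 p r - pullN2 l.1 q r := by
  have h1 : Phi c (p.1 ∪ q.1) ∈ X := X.lower (Phi_mono c Finset.subset_union_left) h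
  have h2 : Phi c (p.1 ∪ r.1) ∈ X :=
    X.lower (Phi_mono c (Finset.union_subset_union_left Finset.subset_union_left)) h
  have h3 : Phi c (q.1 ∪ r.1) ∈ X :=
    X.lower (Phi_mono c (Finset.union_subset_union_left Finset.subset_union_right)) h
  rw [pullN2_eq _ h1, pullN2_eq _ h2, pullN2_eq _ h3]
  have := l.2.2.2 ⟨Phi c p.1, Phi_mem_N_left h1⟩ ⟨Phi c q.1, Phi_mem_N_right h1⟩
    ⟨Phi c r.1, Phi_mem_N_right h2⟩ (Phi_union c p.1 q.1 ▸ h1) (Phi_union c p.1 r.1 ▸ h2)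
    (Phi_union c q.1 r.1 ▸ h3) (by rwa [Phi_union, Phi_union] at h)
  linear_combination this

lemma pullN2_eq_zero {X : Complex n} {c : Deg n} (l : CocyclesN X (posSupp c) (negSupp c))
    (p q : NonFace X) (hp : ¬ negSupp c ⊆ p.1) (hq : ¬ negSupp c ⊆ q.1)
    (h : Phi c (p.1 ∪ q.1) ∈ X) : pullN2 l.1 p q = 0 := by
  rw [pullN2_eq _ h]
  exact l.2.2.1 _ _ _ (Phi_mem_NTilde p.2 (Phi_mem_N_left h).1 hp)
    (Phi_mem_NTilde q.2 (Phi_mem_N_right h).1 hq)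

lemma exists_cocycleHom {X : Complex n} {c : Deg n} (hc : ∀ i, -1 ≤ c i)
    (l : CocyclesN X (posSupp c) (negSupp c)) :
    ∃ φ ∈ RelHomDeg X c, ∀ p q : NonFace X, φ (toRelMod X (taylorRel X p q)) =
      pullN2 l.1 p q • ringMon X (charVec (p.1 ∪ q.1) + c) :=
  exists_relHom hc _ (pullN2_cocycle l) (pullN2_eq_zero l)

lemma pullN2_add {X : Complex n} {c : Deg n} (l l' : N2 X (posSupp c) (negSupp c) → ℂ)
    (p q : NonFace X) : pullN2 (l + l') p q = pullN2 l p q + pullN2 l' p q := by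
  unfold pullN2
  split_ifs <;> simp

lemma pullN2_smul {X : Complex n} {c : Deg n} (k : ℂ) (l : N2 X (posSupp c) (negSupp c) → ℂ)
    (p q : NonFace X) : pullN2 (k • l) p q = k * pullN2 l p q := by
  unfold pullN2
  split_ifs <;> simp

/-- The homomorphism `R/R₀ → A_X` with `R_{p,q} ↦ λ(Φ(p), Φ(q)) x^{(p ∪ q) + c}`. -/
def cocycleHom (X : Complex n) (c : Deg n) (hc : ∀ i, -1 ≤ c i) :
    CocyclesN X (posSupp c) (negSupp c) →ₗ[ℂ] (RelMod X →ₗ[Poly n] SRing X) where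
  -- The choice is linear in `l` because a homomorphism is determined by its values on Taylor
  -- relations.
  toFun l := (exists_cocycleHom hc l).choose
  map_add' l l' := relHom_ext fun p q => by
    rw [LinearMap.add_apply, (exists_cocycleHom hc l).choose_spec.2,
      (exists_cocycleHom hc l').choose_spec.2, (exists_cocycleHom hc (l + l')).choose_spec.2,
      ← add_smul, ← pullN2_add]
    rfl
  map_smul' k l := relHom_ext fun p q => by
    rw [LinearMap.smul_apply, (exists_cocycleHom hc l).choose_spec.2,
      (exists_cocycleHom hc (k • l)).choose_spec.2, RingHom.id_apply, smul_smul, ← pullN2_smul]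
    rfl

lemma cocycleHom_mem {X : Complex n} {c : Deg n} (hc : ∀ i, -1 ≤ c i)
    (l : CocyclesN X (posSupp c) (negSupp c)) : cocycleHom X c hc l ∈ RelHomDeg X c :=
  (exists_cocycleHom hc l).choose_spec.1

lemma cocycleHom_taylorRel {X : Complex n} {c : Deg n} (hc : ∀ i, -1 ≤ c i)
    (l : CocyclesN X (posSupp c) (negSupp c)) (p q : NonFace X) :
    cocycleHom X c hc l (toRelMod X (taylorRel X p q)) =
      pullN2 l.1 p q • ringMon X (charVec (p.1 ∪ q.1) + c) :=
  (exists_cocycleHom hc l).choose_spec.2 p q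

/-! ## The image of `Hom(F, A_X)` -/

lemma freeToHom_taylorRel {X : Complex n} (ψ : Free X →ₗ[Poly n] SRing X) (p q : NonFace X) :
    freeToHom X ψ (toRelMod X (taylorRel X p q)) =
      MvPolynomial.monomial (sqExp (q.1 \ p.1)) (1 : ℂ) • ψ (Pi.single p 1) -
        MvPolynomial.monomial (sqExp (p.1 \ q.1)) (1 : ℂ) • ψ (Pi.single q 1) := by
  change ψ (Pi.single p (sqfree (q.1 \ p.1)) - Pi.single q (sqfree (p.1 \ q.1))) = _
  rw [← map_smul, ← map_smul, ← map_sub, ← Pi.single_smul, ← Pi.single_smul, smul_eq_mul,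
    mul_one, smul_eq_mul, mul_one, sqfree_eq_monomial, sqfree_eq_monomial]

lemma relCoeff_freeToHom {X : Complex n} {c : Deg n} (ψ : Free X →ₗ[Poly n] SRing X)
    (p q : NonFace X) (h : Alive X (charVec (p.1 ∪ q.1) + c)) :
    relCoeff X c (freeToHom X ψ) p q = ringCoeff X (charVec p.1 + c) (ψ (Pi.single p 1)) -
      ringCoeff X (charVec q.1 + c) (ψ (Pi.single q 1)) := by
  rw [relCoeff, freeToHom_taylorRel, map_sub]
  congr 1
  · rw [← intDeg_sdiff_add, ringCoeff_monomial_smul _ (by rwa [intDeg_sdiff_add])]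
  · rw [Finset.union_comm p.1, ← intDeg_sdiff_add,
      ringCoeff_monomial_smul _ (by rwa [intDeg_sdiff_add, Finset.union_comm])]

/-- The map is `e_p ↦ m(p) x^{p+c}`. If `b ⊄ p`, this value is zero, while `x^{(p ∪ q)+c}` may
survive; `hm` makes `m(p)` zero in that case. -/
lemma exists_freeHom {X : Complex n} {c : Deg n} (hc : ∀ i, -1 ≤ c i) (m : NonFace X → ℂ)
    (hm : ∀ p : NonFace X, ¬ negSupp c ⊆ p.1 → Phi c p.1 ∈ X → m p = 0) :
    ∃ ψ : Free X →ₗ[Poly n] SRing X, ∀ p q : NonFace X,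
      freeToHom X ψ (toRelMod X (taylorRel X p q)) =
        (m p - m q) • ringMon X (charVec (p.1 ∪ q.1) + c) := by
  classical
  have key : ∀ p q : NonFace X, MvPolynomial.monomial (sqExp (q.1 \ p.1)) (1 : ℂ) •
      (m p • ringMon X (charVec p.1 + c)) = m p • ringMon X (charVec (p.1 ∪ q.1) + c) := by
    intro p q
    by_cases hb : negSupp c ⊆ p.1
    · rw [smul_comm, monomial_smul_ringMon _ _ ((charVec_nonneg_iff hc _).2 hb),
        intDeg_sdiff_add]
    · rw [ringMon_eq_zero (u := charVec p.1 + c) fun h' => hb ((alive_charVec_iff hc _).1 h').1,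
        smul_zero, smul_zero]
      by_cases ha : Alive X (charVec (p.1 ∪ q.1) + c)
      · rw [hm p hb (Phi_mem_N_left ((alive_charVec_iff hc _).1 ha).2).1, zero_smul]
      · rw [ringMon_eq_zero ha, smul_zero]
  refine ⟨Fintype.linearCombination (Poly n) fun p => m p • ringMon X (charVec p.1 + c),
    fun p q => ?_⟩
  rw [freeToHom_taylorRel, Fintype.linearCombination_apply_single,
    Fintype.linearCombination_apply_single, one_smul, one_smul, key, key, Finset.union_comm q.1,
    sub_smul]

lemma exists_subset_not_mem {X : Complex n} {c : Deg n} {f : Finset (Fin (n + 1))}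
    (hf : f ∈ NTilde X (posSupp c) (negSupp c)) :
    ∃ p : NonFace X, Phi c p.1 = f ∧ ¬ negSupp c ⊆ p.1 := by
  obtain ⟨hN, b', hb, hb'⟩ := hf
  refine ⟨⟨f ∪ b', hb'⟩, Phi_union_of_mem_N hN hb.1, fun h => hb.2 fun i hi => ?_⟩
  rcases Finset.mem_union.1 (h hi) with h' | h'
  · have : i ∈ f ∩ negSupp c := Finset.mem_inter.2 ⟨h', hi⟩
    rw [hN.2.2.1] at this
    exact absurd this (Finset.notMem_empty _)
  · exact h'

/-! ## The graded pieces of `T²` -/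

lemma cocycleHom_mem_range_iff {X : Complex n} {c : Deg n} (hc : ∀ i, -1 ≤ c i)
    (l : CocyclesN X (posSupp c) (negSupp c)) :
    cocycleHom X c hc l ∈ LinearMap.range (freeToHom X) ↔
      l.1 ∈ CoboundariesN X (posSupp c) (negSupp c) := by
  constructor
  · rintro ⟨ψ, hψ⟩
    have hl : ∀ p q : NonFace X, Alive X (charVec (p.1 ∪ q.1) + c) → pullN2 l.1 p q =
        ringCoeff X (charVec p.1 + c) (ψ (Pi.single p 1)) -
          ringCoeff X (charVec q.1 + c) (ψ (Pi.single q 1)) := by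
      intro p q ha
      rw [← relCoeff_freeToHom ψ p q ha, hψ, relCoeff_of_alive ha (cocycleHom_taylorRel hc l p q)]
    have hfill : ∀ f : N X (posSupp c) (negSupp c), Phi c (fill f).1 = f.1 :=
      fun f => Phi_union_of_mem_N f.2 subset_rfl
    have hsub : ∀ f : N X (posSupp c) (negSupp c), negSupp c ⊆ (fill f).1 :=
      fun f => Finset.subset_union_right
    -- The map `ψ` need not be homogeneous; only its coefficients in degrees `p + c` enter.
    refine ⟨fun f => ringCoeff X (charVec (fill f).1 + c) (ψ (Pi.single (fill f) 1)),
      fun f hf => ?_, ?_⟩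
    -- Compare with a second non-face `q` over `f` that does not contain `b`: its coefficient is
    -- zero, so the value at `f` is `λ(f, f)`, which vanishes on `Ñ`.
    · obtain ⟨q, hq, hbq⟩ := exists_subset_not_mem hf
      have hX : Phi c ((fill f).1 ∪ q.1) ∈ X := by
        rw [Phi_union, hfill, hq, Finset.union_self]; exact f.2.1
      have h := hl (fill f) q ((alive_charVec_iff hc _).2
        ⟨(hsub f).trans Finset.subset_union_left, hX⟩)
      rw [ringCoeff_of_not (u := charVec q.1 + c)
        fun h' => hbq ((alive_charVec_iff hc _).1 h').1, LinearMap.zero_apply, sub_zero,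
        pullN2_eq _ hX] at h
      refine h.symm.trans ?_
      refine l.2.2.1 _ _ _ ?_ ?_
      · change Phi c (fill f).1 ∈ _
        rwa [hfill]
      · change Phi c q.1 ∈ _
        rwa [hq]
    · rintro ⟨⟨f, g⟩, hfg⟩
      have hX : Phi c ((fill f).1 ∪ (fill g).1) ∈ X := by rwa [Phi_union, hfill, hfill]
      rw [← hl (fill f) (fill g) ((alive_charVec_iff hc _).2
        ⟨(hsub f).trans Finset.subset_union_left, hX⟩), pullN2_eq _ hX]
      exact congrArg l.1 (Subtype.ext (Prod.ext (Subtype.ext (hfill f).symm)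
        (Subtype.ext (hfill g).symm)))
  · rintro ⟨m, hm, hl⟩
    obtain ⟨ψ, hψ⟩ := exists_freeHom hc (fun p : NonFace X => pullN (c := c) m p.1)
      (fun p hb hX => by
        rw [pullN_of_mem _ (Phi_mem_N p.2 hX)]
        exact hm _ (Phi_mem_NTilde p.2 hX hb))
    refine ⟨ψ, relHom_ext fun p q => ?_⟩
    rw [hψ, cocycleHom_taylorRel]
    by_cases ha : Alive X (charVec (p.1 ∪ q.1) + c)
    · have hX := ((alive_charVec_iff hc _).1 ha).2
      rw [pullN2_eq _ hX, hl, pullN_of_mem _ (Phi_mem_N_left hX),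
        pullN_of_mem _ (Phi_mem_N_right hX)]
    · rw [ringMon_eq_zero ha, smul_zero, smul_zero]

lemma exists_sub_cocycleHom_mem {X : Complex n} {c : Deg n} (hc : ∀ i, -1 ≤ c i)
    {φ : RelMod X →ₗ[Poly n] SRing X} (hφ : φ ∈ RelHomDeg X c) :
    ∃ l, φ - cocycleHom X c hc l ∈ LinearMap.range (freeToHom X) := by
  classical
  have hex : ∀ f : N X (posSupp c) (negSupp c), ∃ p : NonFace X, Phi c p.1 = f.1 ∧
      (f.1 ∈ NTilde X (posSupp c) (negSupp c) → ¬ negSupp c ⊆ p.1) := by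
    intro f
    by_cases hf : f.1 ∈ NTilde X (posSupp c) (negSupp c)
    · obtain ⟨p, hp, hb⟩ := exists_subset_not_mem hf
      exact ⟨p, hp, fun _ => hb⟩
    · exact ⟨fill f, Phi_union_of_mem_N f.2 subset_rfl, fun h => absurd h hf⟩
  -- A section of `Φ` that avoids containing `b` over `Ñ`, so that `relCoeff_eq_zero` gives the
  -- vanishing required of a cocycle.
  choose ρ hρ hρb using hex
  have hself : ∀ p : NonFace X, Phi c p.1 ∈ X → relCoeff X c φ p p = 0 := by
    intro p hp
    have := relCoeff_cocycle hc φ p p p (by rwa [Finset.union_self, Finset.union_self])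
    rwa [sub_self] at this
  let l : CocyclesN X (posSupp c) (negSupp c) :=
    ⟨fun fg => relCoeff X c φ (ρ fg.1.1) (ρ fg.1.2), by
      refine ⟨fun f g hfg hgf => ?_, fun f g hfg hf hg => ?_, fun f g k _ _ _ hX => ?_⟩
      · change relCoeff X c φ (ρ f) (ρ g) = -relCoeff X c φ (ρ g) (ρ f)
        rw [relCoeff_cocycle hc φ (ρ f) (ρ g) (ρ f), hself, zero_sub]
        · rw [hρ]; exact f.2.1
        · rw [Phi_union, Phi_union, hρ, hρ, Finset.union_right_comm, Finset.union_self]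
          exact hfg
      · exact relCoeff_eq_zero hc φ _ _ (hρb f hf) (hρb g hg) (by rwa [Phi_union, hρ, hρ])
      · have := relCoeff_cocycle hc φ (ρ f) (ρ g) (ρ k)
          (by rwa [Phi_union, Phi_union, hρ, hρ, hρ])
        change relCoeff X c φ (ρ f) (ρ g) - relCoeff X c φ (ρ f) (ρ k) +
          relCoeff X c φ (ρ g) (ρ k) = 0
        linear_combination this⟩
  -- The correcting cochain compares `p` with the chosen representative `ρ(Φ(p))` of its fibre. Two
  -- cocycle identities give `m(p) - m(q) = φ_{p,q} - φ_{ρΦ(p),ρΦ(q)}`, where `φ_{p,q}` is the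
  -- coefficient on `R_{p,q}`.
  let m : NonFace X → ℂ := fun p =>
    if h : Phi c p.1 ∈ N X (posSupp c) (negSupp c) then relCoeff X c φ p (ρ ⟨_, h⟩) else 0
  obtain ⟨ψ, hψ⟩ := exists_freeHom hc m (fun p hb hX => by
    simp only [m]
    rw [dif_pos (Phi_mem_N p.2 hX)]
    refine relCoeff_eq_zero hc φ _ _ hb (hρb _ (Phi_mem_NTilde p.2 hX hb)) ?_
    rw [Phi_union, hρ, Finset.union_self]
    exact hX)
  refine ⟨l, ψ, relHom_ext fun p q => ?_⟩
  rw [hψ, LinearMap.sub_apply, relHom_taylorRel hφ, cocycleHom_taylorRel, ← sub_smul]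
  by_cases ha : Alive X (charVec (p.1 ∪ q.1) + c)
  · congr 1
    have hX := ((alive_charVec_iff hc _).1 ha).2
    have hp := Phi_mem_N_left hX
    have hq := Phi_mem_N_right hX
    have hX' := hX
    rw [Phi_union] at hX'
    rw [pullN2_eq _ hX]
    simp only [m]
    rw [dif_pos hp, dif_pos hq]
    change _ = relCoeff X c φ p q - relCoeff X c φ (ρ ⟨_, hp⟩) (ρ ⟨_, hq⟩)
    have h1 := relCoeff_cocycle hc φ p q (ρ ⟨_, hp⟩) (by
      rwa [Phi_union, Phi_union, hρ, Finset.union_right_comm, Finset.union_self])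
    have h2 := relCoeff_cocycle hc φ q (ρ ⟨_, hp⟩) (ρ ⟨_, hq⟩) (by
      rwa [Phi_union, Phi_union, hρ, hρ, Finset.union_right_comm, Finset.union_self,
        Finset.union_comm])
    linear_combination -h1 + h2
  · rw [ringMon_eq_zero ha, smul_zero, smul_zero]

/-- The map from cocycles to `T²`. -/
def cocycleToT2 (X : Complex n) (c : Deg n) (hc : ∀ i, -1 ≤ c i) :
    CocyclesN X (posSupp c) (negSupp c) →ₗ[ℂ] T2 X :=
  (toT2 X).restrictScalars ℂ ∘ₗ cocycleHom X c hc

lemma ker_cocycleToT2 (X : Complex n) (c : Deg n) (hc : ∀ i, -1 ≤ c i) :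
    (CoboundariesN X (posSupp c) (negSupp c)).submoduleOf (CocyclesN X (posSupp c) (negSupp c)) =
      LinearMap.ker (cocycleToT2 X c hc) := by
  ext l
  rw [LinearMap.mem_ker]
  exact (cocycleHom_mem_range_iff hc l).symm.trans (Submodule.Quotient.mk_eq_zero _).symm

lemma range_cocycleToT2 (X : Complex n) (c : Deg n) (hc : ∀ i, -1 ≤ c i) :
    LinearMap.range (cocycleToT2 X c hc) = T2Deg X c := by
  refine le_antisymm ?_ ?_
  · rintro _ ⟨l, rfl⟩
    exact ⟨_, cocycleHom_mem hc l, rfl⟩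
  · rintro _ ⟨φ, hφ, rfl⟩
    obtain ⟨l, hl⟩ := exists_sub_cocycleHom_mem hc hφ
    exact ⟨l, ((Submodule.Quotient.eq _).2 hl).symm⟩

/-- The isomorphism of cocycles modulo coboundaries with `T²_c(X)`. -/
def t2Equiv (X : Complex n) (c : Deg n) (hc : ∀ i, -1 ≤ c i) :
    T2N X (posSupp c) (negSupp c) ≃ₗ[ℂ] T2Deg X c :=
  Submodule.quotEquivOfEq _ _ (ker_cocycleToT2 X c hc) ≪≫ₗ
    (cocycleToT2 X c hc).quotKerEquivRange ≪≫ₗ LinearEquiv.ofEq _ _ (range_cocycleToT2 X c hc)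

lemma t2Equiv_mk {X : Complex n} {c : Deg n} (hc : ∀ i, -1 ≤ c i)
    (l : CocyclesN X (posSupp c) (negSupp c)) :
    (t2Equiv X c hc (Submodule.Quotient.mk l)).1 = toT2 X (cocycleHom X c hc l) := rfl

end

end StanleyReisner

theorem proposition2p3 (n : ℕ) (X : StanleyReisner.Complex n) (c : StanleyReisner.Deg n) :
    -- vanishing unless all entries of the negative part of `c` are 0 or 1
    ((¬ ∀ i, -1 ≤ c i) →
      StanleyReisner.HomDeg X c = ⊥ ∧ StanleyReisner.T2Deg X c = ⊥) ∧
    ((∀ i, -1 ≤ c i) →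
      -- dependence on the supports only
      (∀ c' : StanleyReisner.Deg n, (∀ i, -1 ≤ c' i) →
        StanleyReisner.posSupp c' = StanleyReisner.posSupp c →
        StanleyReisner.negSupp c' = StanleyReisner.negSupp c →
        Nonempty (StanleyReisner.HomDeg X c ≃ₗ[ℂ] StanleyReisner.HomDeg X c') ∧
        Nonempty (StanleyReisner.T2Deg X c ≃ₗ[ℂ] StanleyReisner.T2Deg X c')) ∧
      -- (i) and (ii)
      (∃ E : StanleyReisner.HomDeg X c ≃ₗ[ℂ]
          StanleyReisner.HomN X (StanleyReisner.posSupp c) (StanleyReisner.negSupp c),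
        (∀ (φ : StanleyReisner.HomDeg X c) (p : StanleyReisner.NonFace X)
          (hp : StanleyReisner.Phi c p.1 ∈
            StanleyReisner.N X (StanleyReisner.posSupp c) (StanleyReisner.negSupp c)),
          φ.1 (StanleyReisner.gen X p) =
            (E φ).1 ⟨StanleyReisner.Phi c p.1, hp⟩ • StanleyReisner.toRing X
              (StanleyReisner.zMonomial (StanleyReisner.charVec p.1 + c))) ∧
        ∀ φ : StanleyReisner.HomDeg X c,
          φ.1 ∈ StanleyReisner.TrivialDeg X c ↔
            φ = 0 ∨ ((StanleyReisner.negSupp c).card = 1 ∧ ∃ k : ℂ, ∀ f, (E φ).1 f = k)) ∧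
      -- (iii)
      (∃ E : StanleyReisner.T2Deg X c ≃ₗ[ℂ]
          StanleyReisner.T2N X (StanleyReisner.posSupp c) (StanleyReisner.negSupp c),
        ∀ l : StanleyReisner.CocyclesN X (StanleyReisner.posSupp c) (StanleyReisner.negSupp c),
          ∃ φ ∈ StanleyReisner.RelHomDeg X c,
            (∀ (p q : StanleyReisner.NonFace X)
              (hp : StanleyReisner.Phi c p.1 ∈
                StanleyReisner.N X (StanleyReisner.posSupp c) (StanleyReisner.negSupp c))
              (hq : StanleyReisner.Phi c q.1 ∈
                StanleyReisner.N X (StanleyReisner.posSupp c) (StanleyReisner.negSupp c))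
              (hpq : StanleyReisner.Phi c p.1 ∪ StanleyReisner.Phi c q.1 ∈ X),
              φ (StanleyReisner.toRelMod X (StanleyReisner.taylorRel X p q)) =
                l.1 ⟨(⟨StanleyReisner.Phi c p.1, hp⟩, ⟨StanleyReisner.Phi c q.1, hq⟩), hpq⟩ •
                  StanleyReisner.toRing X
                    (StanleyReisner.zMonomial (StanleyReisner.charVec (p.1 ∪ q.1) + c))) ∧
            (E.symm (Submodule.Quotient.mk l)).1 = StanleyReisner.toT2 X φ)) := by
  refine ⟨fun hc => ⟨StanleyReisner.homDeg_eq_bot X hc, ?_⟩, fun hc => ⟨?_, ?_, ?_⟩⟩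
  · rw [StanleyReisner.T2Deg, StanleyReisner.relHomDeg_eq_bot X hc, Submodule.map_bot]
  · intro c' hc' ha hb
    have e₁ := StanleyReisner.homEquiv X c' hc'
    have e₂ := StanleyReisner.t2Equiv X c' hc'
    -- The target spaces involve `c'` only through its two supports, so they become those of `c`.
    rw [ha, hb] at e₁ e₂
    exact ⟨⟨StanleyReisner.homEquiv X c hc ≪≫ₗ e₁.symm⟩,
      ⟨(StanleyReisner.t2Equiv X c hc).symm ≪≫ₗ e₂⟩⟩
  · exact ⟨StanleyReisner.homEquiv X c hc, StanleyReisner.hom_gen_eq hc,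
      StanleyReisner.mem_TrivialDeg_iff hc⟩
  · refine ⟨(StanleyReisner.t2Equiv X c hc).symm, fun l =>
      ⟨StanleyReisner.cocycleHom X c hc l, StanleyReisner.cocycleHom_mem hc l,
        fun p q hp hq hpq => ?_, StanleyReisner.t2Equiv_mk hc l⟩⟩
    rw [StanleyReisner.cocycleHom_taylorRel, StanleyReisner.pullN2_of_mem _ hp hq hpq]
    rfl
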